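/- Let $n\ge 3$, let $M^n$ be a nonempty smooth manifold and let $x:M^n\to\mathbb R^{n+1}$ be a smooth immersed hypersurface with smooth unit normal field $\xi:M\to\mathbb S^n$. Let $k_1,\dots,k_n$ be its principal curvatures, counted with multiplicity ($d\xi(e_i)=-k_i\,dx(e_i)$). Suppose that no $k_i$ vanishes anywhere and that $x$ has no umbilic points, i.e. at no point are all the $k_i$ equal (some of them may coincide). Notation. Put $r_i=1/k_i$, $r=\frac1n\sum_i r_i$, $\rho=\sqrt{\sum_i(r-r_i)^2}>0$. On $\mathbb R^{n+4}$ use $\langle X,X'\rangle=-X_1X_1'+X_2X_2'+\dots+X_{n+3}X_{n+3}'-X_{n+4}X_{n+4}'$, and put $P=(1,-1,0,0)$ with $0\in\mathbb R^{n+1}$ in the third place. Let $Y=\rho\,(x\cdot\xi,-x\cdot\xi,\xi,1)$ be the Laguerre position vector, $g=\rho^2\,d\xi\cdot d\xi=\langle dY,dY\rangle$ the Laguerre metric, $\nabla$ and $\Delta_g$ its Levi-Civita connection and Laplacian, and $$N=\tfrac1n\Delta_gY+\tfrac1{2n^2}\langle\Delta_gY,\Delta_gY\rangle Y,\qquad \eta=\bigl(\tfrac12(1+|x|^2),\tfrac12(1-|x|^2),x,0\bigr)+r\,(x\cdot\xi,-x\cdot\xi,\xi,1).$$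 For a local $g$-orthonormal frame $E_1,\dots,E_n$, the vectors $Y,N,E_1(Y),\dots,E_n(Y),\eta,P$ form a moving frame of $\mathbb R^{n+4}$, and the Laguerre tensor $\mathbb L=(L_{ij})$, the Laguerre second fundamental form $\mathbb B=(B_{ij})$ and the Laguerre form $\mathbb C=(C_i)$ are the coefficients in the structure equations $$E_j(E_i(Y))-(\nabla_{E_j}E_i)(Y)=L_{ij}Y+\delta_{ij}N+B_{ij}P,\qquad E_i(N)=\sum_jL_{ij}E_j(Y)+C_iP,$$ that is, $L_{ij}=-\langle\nabla^2_{ij}Y,N\rangle$, $B_{ij}=-\langle\nabla^2_{ij}Y,\eta\rangle$, $C_i=-\langle E_i(N),\eta\rangle$. The eigenvalues $b_i$ of $\mathbb B$ with respect to $g$ are the Laguerre principal curvatures. The hypersurface $x$ is L-isotropic with constant $\lambda\in\mathbb R$ if $\mathbb C=0$ and $L_{ij}=\lambda\delta_{ij}$ on $M$; it is L-isoparametric if $\mathbb C=0$ and all the Laguerre principal curvatures are constant on $M$. Claim. If $x$ is L-isotropic with constant $\lambda$ and also L-isoparametric, then $\lambda=0$; that is, at every point all $n$ eigenvalues of the Laguerre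 tensor $\mathbb L$ with respect to $g$ are equal to $0$. -/

import Mathlib

open scoped Manifold ContDiff

noncomputable section

namespace Laguerre

/-- Euclidean space `ℝⁿ`. -/
abbrev Euc (n : ℕ) : Type := EuclideanSpace ℝ (Fin n)

/-- The vector space `ℝⁿ⁺⁴`, with the coordinates grouped as
`(X₁, X₂, (X₃, …, Xₙ₊₃), Xₙ₊₄)`. -/
abbrev LSpace (n : ℕ) : Type := ℝ × ℝ × Euc (n + 1) × ℝ

/-- The inner product `-X₁Y₁ + X₂Y₂ + ⋯ + Xₙ₊₃Yₙ₊₃ - Xₙ₊₄Yₙ₊₄` of `ℝⁿ⁺⁴₂`. -/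
def form {n : ℕ} (X Y : LSpace n) : ℝ :=
  -(X.1 * Y.1) + X.2.1 * Y.2.1 + inner ℝ X.2.2.1 Y.2.2.1 - X.2.2.2 * Y.2.2.2

/-! ### Calculus in coordinates

`G` denotes the matrix-valued function of the components of a Riemannian metric on an open
subset of `ℝⁿ`. -/

/-- The partial derivative `∂ₐF (u)`. -/
def pd {n : ℕ} {V : Type*} [NormedAddCommGroup V] [NormedSpace ℝ V]
    (a : Fin n) (F : Euc n → V) (u : Euc n) : V :=
  fderiv ℝ F u (EuclideanSpace.single a 1)

/-- The Christoffel symbol `Γᶜₐᵦ` of the Levi-Civita connection of `G`. -/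
def christoffel {n : ℕ} (G : Euc n → Matrix (Fin n) (Fin n) ℝ) (c a b : Fin n)
    (u : Euc n) : ℝ :=
  (1 / 2) * ∑ d, (G u)⁻¹ c d *
    (pd a (fun w => G w b d) u + pd b (fun w => G w a d) u - pd d (fun w => G w a b) u)

/-- The component `∂ₐ∂ᵦF - ∑ᶜ Γᶜₐᵦ ∂ᶜF` of the Hessian of a vector-valued function `F` with
respect to `G`. -/
def hess {n : ℕ} {V : Type*} [NormedAddCommGroup V] [NormedSpace ℝ V]
    (G : Euc n → Matrix (Fin n) (Fin n) ℝ) (F : Euc n → V) (a b : Fin n) (u : Euc n) : V :=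
  pd a (pd b F) u - ∑ c, christoffel G c a b u • pd c F u

/-- The Laplacian (trace of the Hessian) of `F` with respect to `G`. -/
def laplacian {n : ℕ} {V : Type*} [NormedAddCommGroup V] [NormedSpace ℝ V]
    (G : Euc n → Matrix (Fin n) (Fin n) ℝ) (F : Euc n → V) (u : Euc n) : V :=
  ∑ a, ∑ b, (G u)⁻¹ a b • hess G F a b u

/-- The eigenvalues, with multiplicity, of the symmetric bilinear form with matrix `T` relative
to the inner product with matrix `g`. -/
def eigenvaluesRel {n : ℕ} (g T : Matrix (Fin n) (Fin n) ℝ) : Multiset ℝ :=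
  (g⁻¹ * T).charpoly.roots

/-! ### Laguerre invariants of a parametrized hypersurface

`x` is a local parametrization of a hypersurface of `ℝⁿ⁺¹` and `ξ` is its unit normal, both
expressed in coordinates `u = (u₁, …, uₙ)`. -/

section Local

variable {n : ℕ} (x ξ : Euc n → Euc (n + 1))

/-- The first fundamental form `dx · dx`. -/
def firstForm (u : Euc n) : Matrix (Fin n) (Fin n) ℝ :=
  Matrix.of fun a b => inner ℝ (pd a x u) (pd b x u)

/-- The second fundamental form `-dx · dξ`. -/
def secondForm (u : Euc n) : Matrix (Fin n) (Fin n) ℝ :=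
  Matrix.of fun a b => -inner ℝ (pd a x u) (pd b ξ u)

/-- The third fundamental form `dξ · dξ`. -/
def thirdForm (u : Euc n) : Matrix (Fin n) (Fin n) ℝ :=
  Matrix.of fun a b => inner ℝ (pd a ξ u) (pd b ξ u)

/-- The principal curvatures `kᵢ` with multiplicity: the eigenvalues of the second fundamental
form relative to the first one, that is, of the shape operator `S`, `dξ = -dx ∘ S`. -/
def principalCurvatures (u : Euc n) : Multiset ℝ :=
  eigenvaluesRel (firstForm x u) (secondForm x ξ u)

/-- The curvature radii `rᵢ = 1 / kᵢ`, with multiplicity. -/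
def radii (u : Euc n) : Multiset ℝ :=
  (principalCurvatures x ξ u).map fun k => 1 / k

/-- The mean curvature radius `r = (r₁ + ⋯ + rₙ) / n`. -/
def meanRadius (u : Euc n) : ℝ :=
  (radii x ξ u).sum / n

/-- `ρ = √(∑ᵢ (r - rᵢ)²)`. -/
def rho (u : Euc n) : ℝ :=
  √(((radii x ξ u).map fun s => (meanRadius x ξ u - s) ^ 2).sum)

/-- `y = (x · ξ, -x · ξ, ξ, 1)`. -/
def unscaledPosition (u : Euc n) : LSpace n :=
  (inner ℝ (x u) (ξ u), -inner ℝ (x u) (ξ u), ξ u, 1)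

/-- The Laguerre position vector `Y = ρ y`. -/
def position (u : Euc n) : LSpace n :=
  rho x ξ u • unscaledPosition x ξ u

/-- The Laguerre metric `g = ρ² dξ · dξ`. -/
def metric (u : Euc n) : Matrix (Fin n) (Fin n) ℝ :=
  rho x ξ u ^ 2 • thirdForm ξ u

/-- The vector `N = (1/n) ΔY + (1/(2n²)) ⟨ΔY, ΔY⟩ Y`, `Δ` being the Laplacian of `g`. -/
def nVector (u : Euc n) : LSpace n :=
  (1 / (n : ℝ)) • laplacian (metric x ξ) (position x ξ) u +
    (1 / (2 * (n : ℝ) ^ 2) *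
      form (laplacian (metric x ξ) (position x ξ) u)
        (laplacian (metric x ξ) (position x ξ) u)) • position x ξ u

/-- The Laguerre normal map
`η = ((1 + |x|²)/2, (1 - |x|²)/2, x, 0) + r (x · ξ, -x · ξ, ξ, 1)`. -/
def eta (u : Euc n) : LSpace n :=
  ((1 + ‖x u‖ ^ 2) / 2, (1 - ‖x u‖ ^ 2) / 2, x u, 0) +
    meanRadius x ξ u • unscaledPosition x ξ u

/-! The Laguerre invariants are the coefficients in the structure equations
`E_j E_i Y - ∑ₖ Γᵏᵢⱼ E_k Y = Lᵢⱼ Y + δᵢⱼ N + Bᵢⱼ P` and `E_i N = ∑ⱼ Lᵢⱼ E_j Y + Cᵢ P`,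
with `P = (1, -1, 0, 0)`. In the moving frame `Y, N, E₁Y, …, EₙY, η, P` the only nonzero
products are `⟨Y, N⟩ = -1`, `⟨η, P⟩ = -1` and `⟨E_i Y, E_i Y⟩ = 1`, so the coefficient of `Y` is
minus the product with `N` and the coefficient of `P` is minus the product with `η`. Below,
the components refer to the coordinate frame. -/

/-- The Laguerre tensor `𝕃`: the `Y`-coefficient of the Hessian of `Y`. -/
def laguerreTensor (u : Euc n) : Matrix (Fin n) (Fin n) ℝ :=
  Matrix.of fun a b => -form (hess (metric x ξ) (position x ξ) a b u) (nVector x ξ u)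

/-- The Laguerre second fundamental form `𝔹`: the `P`-coefficient of the Hessian of `Y`. -/
def laguerreSecondForm (u : Euc n) : Matrix (Fin n) (Fin n) ℝ :=
  Matrix.of fun a b => -form (hess (metric x ξ) (position x ξ) a b u) (eta x ξ u)

/-- The Laguerre form `ℂ`: the `P`-coefficient of `dN`. -/
def laguerreForm (u : Euc n) (a : Fin n) : ℝ :=
  -form (pd a (nVector x ξ) u) (eta x ξ u)

/-- The eigenvalues of the Laguerre tensor with respect to the Laguerre metric. -/
def tensorEigenvalues (u : Euc n) : Multiset ℝ :=
  eigenvaluesRel (metric x ξ u) (laguerreTensor x ξ u)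

/-- The Laguerre principal curvatures: the eigenvalues of the Laguerre second fundamental form
with respect to the Laguerre metric. -/
def laguerrePrincipalCurvatures (u : Euc n) : Multiset ℝ :=
  eigenvaluesRel (metric x ξ u) (laguerreSecondForm x ξ u)

end Local

/-! ### Hypersurfaces `x : Mⁿ → ℝⁿ⁺¹`

Tensors on `M` are given by their components in the charts `e` of the atlas of `M`; in such a
chart the hypersurface and its normal are `x ∘ e.symm` and `ξ ∘ e.symm`, defined on the open
set `e.target` of `ℝⁿ`. -/

section Global

variable {n : ℕ} {M : Type*} [TopologicalSpace M] [ChartedSpace (Euc n) M]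

/-- `x` is a smooth immersed hypersurface with smooth unit normal field `ξ`. -/
structure IsOrientedHypersurface (x ξ : M → Euc (n + 1)) : Prop where
  smooth : ContMDiff (𝓡 n) 𝓘(ℝ, Euc (n + 1)) ∞ x
  smooth_normal : ContMDiff (𝓡 n) 𝓘(ℝ, Euc (n + 1)) ∞ ξ
  immersion : ∀ p : M, Function.Injective (mfderiv (𝓡 n) 𝓘(ℝ, Euc (n + 1)) x p)
  unit : ∀ p : M, ‖ξ p‖ = 1
  normal : ∀ (p : M) (v : TangentSpace (𝓡 n) p),
    @inner ℝ (Euc (n + 1)) _ (mfderiv (𝓡 n) 𝓘(ℝ, Euc (n + 1)) x p v) (ξ p) = 0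

/-- No principal curvature vanishes at any point. -/
def NonvanishingCurvatures (x ξ : M → Euc (n + 1)) : Prop :=
  ∀ e ∈ atlas (Euc n) M, ∀ u ∈ e.target, 0 ∉ principalCurvatures (x ∘ e.symm) (ξ ∘ e.symm) u

/-- There are no umbilic points: at no point are all the principal curvatures equal. -/
def UmbilicFree (x ξ : M → Euc (n + 1)) : Prop :=
  ∀ e ∈ atlas (Euc n) M, ∀ u ∈ e.target,
    ¬ ∃ k : ℝ, ∀ k' ∈ principalCurvatures (x ∘ e.symm) (ξ ∘ e.symm) u, k' = k

/-- The Laguerre form `ℂ` vanishes identically. -/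
def VanishingLaguerreForm (x ξ : M → Euc (n + 1)) : Prop :=
  ∀ e ∈ atlas (Euc n) M, ∀ u ∈ e.target, ∀ a, laguerreForm (x ∘ e.symm) (ξ ∘ e.symm) u a = 0

/-- `x` is L-isotropic with constant `lam`: `ℂ = 0` and `𝕃 = lam g`
(that is, `Lᵢⱼ = lam δᵢⱼ` in `g`-orthonormal frames). -/
def IsLIsotropic (x ξ : M → Euc (n + 1)) (lam : ℝ) : Prop :=
  VanishingLaguerreForm x ξ ∧
    ∀ e ∈ atlas (Euc n) M, ∀ u ∈ e.target,
      laguerreTensor (x ∘ e.symm) (ξ ∘ e.symm) u = lam • metric (x ∘ e.symm) (ξ ∘ e.symm) u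

/-- `x` is L-isoparametric: `ℂ = 0` and the Laguerre principal curvatures are constant. -/
def IsLIsoparametric (x ξ : M → Euc (n + 1)) : Prop :=
  VanishingLaguerreForm x ξ ∧
    ∃ β : Multiset ℝ, ∀ e ∈ atlas (Euc n) M, ∀ u ∈ e.target,
      laguerrePrincipalCurvatures (x ∘ e.symm) (ξ ∘ e.symm) u = β

end Global

end Laguerre

end

/-! The vector $Y$ maps $M$ isometrically, for the metric $g$, into a flat space, and
$\nabla^2Y=\mathbb L\,Y+g\,N+\mathbb B\,P$ is its normal-valued second fundamental form. Since $P$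
is null and orthogonal to $Y$ and $N$, while $\langle Y,N\rangle=-1$, the condition $\mathbb
L=\lambda g$ makes the Gauss equation say that $g$ has constant curvature $-2\lambda$. The condition
$\mathbb C=0$ means $d\eta=dY\circ A$ with $A=g^{-1}\mathbb B$, so $\mathbb B$ is a Codazzi tensor,
here with constant eigenvalues $\mu_j$.

Cartan's argument for isoparametric hypersurfaces then applies. For $\mu_i\ne\mu_k$, the Codazzi
equation kills certain connection coefficients identically; differentiating these relations and
commuting derivatives gives $\lambda=-\sum_j\tau_j^2/\bigl((\mu_k-\mu_j)(\mu_i-\mu_j)\bigr)$, where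
only $j$ with $\mu_j\ne\mu_i,\mu_k$ contribute. If $\mu_i$ and $\mu_k$ are the two largest distinct
values, all denominators that occur are positive and $\lambda\le0$; if they are the largest and the
smallest, all are negative and $\lambda\ge0$. Two distinct values exist because there are no
umbilics.

The curvature tensor never appears: `cartan_identity` works with flat derivatives of $Y$ and $\eta$
and with products of second derivatives (`gauss_identity`). The relation $d\eta=dY\circ A$ is
`pd_eta_eq`, and the sign argument is `eq_zero_of_cartan_identity`. The smooth eigenvector fields
are built in `isotropic_constant_eq_zero` by applying Lagrange polynomials to $A$. -/

noncomputable section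

namespace Laguerre

/-! ### Eigenvalues of a symmetric form relative to an inner product -/

section MatrixLemmas

open Matrix Polynomial

variable {n : ℕ}

/-- Simultaneous diagonalization of an inner product and a symmetric bilinear form. -/
theorem exists_simultaneous_diagonalization {g T : Matrix (Fin n) (Fin n) ℝ} (hg : g.PosDef)
    (hT : Tᵀ = T) :
    ∃ (Q : Matrix (Fin n) (Fin n) ℝ) (d : Fin n → ℝ), Qᵀ * g * Q = 1 ∧
      Qᵀ * T * Q = diagonal d := by
  -- Writing $g=C^TC$ reduces the problem to the spectral theorem for the symmetric matrix
  -- $C^{-T}TC^{-1}$.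
  obtain ⟨C, hC, hgC⟩ : ∃ C : Matrix (Fin n) (Fin n) ℝ, IsUnit C ∧ g = Cᵀ * C := by
    open scoped MatrixOrder in
    have h := (CStarAlgebra.isStrictlyPositive_iff_eq_star_mul_self (a := g)).1
      hg.isStrictlyPositive
    obtain ⟨C, hC, h⟩ := h
    exact ⟨C, hC, by simpa [star_eq_conjTranspose] using h⟩
  have hdet : IsUnit C.det := (isUnit_iff_isUnit_det C).1 hC
  have hCC : C * C⁻¹ = 1 := mul_nonsing_inv C hdet
  have hCC' : (C⁻¹)ᵀ * Cᵀ = 1 := by rw [← transpose_mul, hCC, transpose_one]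
  have hH : ((C⁻¹)ᵀ * T * C⁻¹).IsHermitian := by
    rw [IsHermitian, conjTranspose_eq_transpose_of_trivial]
    simp [transpose_mul, hT, Matrix.mul_assoc]
  set U : Matrix (Fin n) (Fin n) ℝ := hH.eigenvectorUnitary.1 with hU
  have hUU : Uᵀ * U = 1 := by
    have := Unitary.coe_star_mul_self hH.eigenvectorUnitary
    simpa [star_eq_conjTranspose] using this
  have hs := hH.spectral_theorem
  rw [Unitary.conjStarAlgAut_apply] at hs
  refine ⟨C⁻¹ * U, hH.eigenvalues, ?_, ?_⟩
  · calc (C⁻¹ * U)ᵀ * g * (C⁻¹ * U) = Uᵀ * ((C⁻¹)ᵀ * Cᵀ) * (C * C⁻¹) * U := by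
          rw [hgC, transpose_mul]; simp only [Matrix.mul_assoc]
      _ = 1 := by rw [hCC, hCC', Matrix.mul_one, Matrix.mul_one, hUU]
  · calc (C⁻¹ * U)ᵀ * T * (C⁻¹ * U) = Uᵀ * ((C⁻¹)ᵀ * T * C⁻¹) * U := by
          rw [transpose_mul]; simp only [Matrix.mul_assoc]
      _ = Uᵀ * (U * diagonal hH.eigenvalues * Uᵀ) * U := by
          refine congrArg (fun Z => Uᵀ * Z * U) (hs.trans ?_)
          rw [star_eq_conjTranspose, conjTranspose_eq_transpose_of_trivial]
          rfl
      _ = (Uᵀ * U) * diagonal hH.eigenvalues * (Uᵀ * U) := by simp only [Matrix.mul_assoc]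
      _ = _ := by rw [hUU, Matrix.one_mul, Matrix.mul_one]

theorem mul_transpose_mul_eq_one {g Q : Matrix (Fin n) (Fin n) ℝ} (h : Qᵀ * g * Q = 1) :
    Q * (Qᵀ * g) = 1 :=
  mul_eq_one_comm.1 h

theorem inv_eq_mul_transpose {g Q : Matrix (Fin n) (Fin n) ℝ} (h : Qᵀ * g * Q = 1) :
    g⁻¹ = Q * Qᵀ :=
  inv_eq_left_inv (by rw [Matrix.mul_assoc]; exact mul_transpose_mul_eq_one h)

/-- Since $Q^TgQ=1$, the inverse of $Q$ is $Q^Tg$; the right-hand side is a conjugate of a diagonal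
matrix. -/
theorem inv_mul_eq_conj {g T Q : Matrix (Fin n) (Fin n) ℝ} {d : Fin n → ℝ}
    (h : Qᵀ * g * Q = 1) (hT : Qᵀ * T * Q = diagonal d) :
    g⁻¹ * T = Q * diagonal d * (Qᵀ * g) := by
  have h1 := mul_transpose_mul_eq_one h
  rw [inv_eq_mul_transpose h, ← hT]
  calc Q * Qᵀ * T = Q * Qᵀ * T * (Q * (Qᵀ * g)) := by rw [h1, Matrix.mul_one]
    _ = _ := by simp only [Matrix.mul_assoc]

theorem inv_mul_mul_eq {g T Q : Matrix (Fin n) (Fin n) ℝ} {d : Fin n → ℝ}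
    (h : Qᵀ * g * Q = 1) (hT : Qᵀ * T * Q = diagonal d) :
    g⁻¹ * T * Q = Q * diagonal d := by
  rw [inv_mul_eq_conj h hT, Matrix.mul_assoc, h, Matrix.mul_one]

theorem charpoly_conj {g Q : Matrix (Fin n) (Fin n) ℝ} (h : Qᵀ * g * Q = 1)
    (D : Matrix (Fin n) (Fin n) ℝ) : (Q * D * (Qᵀ * g)).charpoly = D.charpoly := by
  rw [charpoly_mul_comm, ← Matrix.mul_assoc, h, Matrix.one_mul]

theorem trace_conj {g Q D : Matrix (Fin n) (Fin n) ℝ} (h : Qᵀ * g * Q = 1) :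
    (Q * D * (Qᵀ * g)).trace = D.trace := by
  rw [Matrix.trace_mul_comm, ← Matrix.mul_assoc, h, Matrix.one_mul]

theorem eigenvaluesRel_eq {g T Q : Matrix (Fin n) (Fin n) ℝ} {d : Fin n → ℝ}
    (h : Qᵀ * g * Q = 1) (hT : Qᵀ * T * Q = diagonal d) :
    eigenvaluesRel g T = Finset.univ.val.map d := by
  rw [eigenvaluesRel, inv_mul_eq_conj h hT, charpoly_conj h, charpoly_diagonal]
  exact roots_multiset_prod_X_sub_C (Finset.univ.val.map d) ▸ by
    rw [Multiset.map_map]; rfl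

theorem aeval_mulVec_of_eigenvector {A : Matrix (Fin n) (Fin n) ℝ} {v : Fin n → ℝ} {μ : ℝ}
    (h : A *ᵥ v = μ • v) (p : ℝ[X]) : aeval A p *ᵥ v = p.eval μ • v := by
  induction p using Polynomial.induction_on' with
  | add p q hp hq => rw [map_add, add_mulVec, hp, hq, eval_add, add_smul]
  | monomial k a =>
    rw [aeval_monomial, eval_monomial]
    have : ∀ k : ℕ, A ^ k *ᵥ v = μ ^ k • v := by
      intro k
      induction k with
      | zero => simp
      | succ k ih => rw [pow_succ, ← mulVec_mulVec, h, mulVec_smul, ih, smul_smul, pow_succ, mul_comm]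
    rw [← mulVec_mulVec, this, Algebra.algebraMap_eq_smul_one, smul_mulVec, one_mulVec, smul_smul]

/-- A polynomial vanishing at the eigenvalues of a diagonalizable matrix annihilates it. -/
theorem aeval_eq_zero_of_eigenvalues {g T Q : Matrix (Fin n) (Fin n) ℝ} {d : Fin n → ℝ}
    (h : Qᵀ * g * Q = 1) (hd : Qᵀ * T * Q = diagonal d) (p : ℝ[X])
    (hp : ∀ ν ∈ eigenvaluesRel g T, p.eval ν = 0) : aeval (g⁻¹ * T) p = 0 := by
  rw [eigenvaluesRel_eq h hd] at hp
  have hz : aeval (g⁻¹ * T) p * Q = 0 := by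
    ext a j
    have h1 : (g⁻¹ * T) *ᵥ Q.col j = d j • Q.col j := by
      ext b
      have := congrFun (congrFun (inv_mul_mul_eq h hd) b) j
      rw [mul_diagonal] at this
      rw [Pi.smul_apply, smul_eq_mul, mul_comm]
      exact this
    have h2 := congrFun (aeval_mulVec_of_eigenvector h1 p) a
    rw [hp (d j) (Multiset.mem_map_of_mem d (Finset.mem_univ_val j)), zero_smul] at h2
    exact h2
  calc aeval (g⁻¹ * T) p = aeval (g⁻¹ * T) p * Q * (Qᵀ * g) := by
        rw [Matrix.mul_assoc, mul_transpose_mul_eq_one h, Matrix.mul_one]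
    _ = 0 := by rw [hz, Matrix.zero_mul]

/-- Applied to a diagonalizable matrix with spectrum in `s`, such a `q` sends every vector into the
$\mu$-eigenspace and fixes the vectors already there. Being polynomial, this projection depends
smoothly on the matrix, whatever the multiplicities. -/
theorem exists_eval_eq_one_zero (s : Finset ℝ) (μ : ℝ) :
    ∃ q : ℝ[X], q.eval μ = 1 ∧ ∀ ν ∈ s, (q * (X - C μ)).eval ν = 0 := by
  -- The node `μ` is inserted because it is not assumed to lie in `s`.
  refine ⟨Lagrange.basis (insert μ s) id μ, ?_, fun ν hν => ?_⟩
  · exact Lagrange.eval_basis_self (v := id) Function.injective_id.injOn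
      (Finset.mem_insert_self _ _)
  · rw [eval_mul]
    by_cases h : μ = ν
    · simp [h]
    · have := Lagrange.eval_basis_of_ne (s := insert μ s) (v := id) h (Finset.mem_insert_of_mem hν)
      rw [id] at this
      rw [this, zero_mul]

end MatrixLemmas

/-! ### Bilinearity of the product and its Leibniz rule -/

section Form

variable {n : ℕ}

theorem form_comm (X Y : LSpace n) : form X Y = form Y X := by
  simp only [form, real_inner_comm]
  ring

theorem form_add_left (X X' Y : LSpace n) : form (X + X') Y = form X Y + form X' Y := by
  simp only [form, Prod.fst_add, Prod.snd_add, inner_add_left]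
  ring

theorem form_smul_left (c : ℝ) (X Y : LSpace n) : form (c • X) Y = c * form X Y := by
  simp only [form, Prod.smul_fst, Prod.smul_snd, real_inner_smul_left, smul_eq_mul]
  ring

theorem form_add_right (X Y Y' : LSpace n) : form X (Y + Y') = form X Y + form X Y' := by
  rw [form_comm, form_add_left, form_comm Y, form_comm Y']

theorem form_smul_right (c : ℝ) (X Y : LSpace n) : form X (c • Y) = c * form X Y := by
  rw [form_comm, form_smul_left, form_comm Y]

/-- `form` as a continuous bilinear map. -/
def formL (n : ℕ) : LSpace n →L[ℝ] LSpace n →L[ℝ] ℝ :=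
  LinearMap.toContinuousBilinearMap
    (LinearMap.mk₂ ℝ form form_add_left form_smul_left form_add_right form_smul_right)

theorem formL_apply (X Y : LSpace n) : formL n X Y = form X Y := rfl

theorem form_sub_left (X X' Y : LSpace n) : form (X - X') Y = form X Y - form X' Y := by
  simp only [← formL_apply, map_sub, _root_.sub_apply]

theorem form_zero_left (Y : LSpace n) : form 0 Y = 0 := by
  simp only [← formL_apply, map_zero, _root_.zero_apply]

theorem form_zero_right (Y : LSpace n) : form Y 0 = 0 := by
  simp only [← formL_apply, map_zero]

theorem form_sum_left {ι : Type*} (s : Finset ι) (X : ι → LSpace n) (Y : LSpace n) :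
    form (∑ i ∈ s, X i) Y = ∑ i ∈ s, form (X i) Y := by
  simp only [← formL_apply, map_sum, _root_.sum_apply]

theorem form_sum_right {ι : Type*} (s : Finset ι) (X : ι → LSpace n) (Y : LSpace n) :
    form Y (∑ i ∈ s, X i) = ∑ i ∈ s, form Y (X i) := by
  simp only [← formL_apply, map_sum]

theorem fderiv_form {f g : Euc n → LSpace n} {u : Euc n} (hf : DifferentiableAt ℝ f u)
    (hg : DifferentiableAt ℝ g u) (v : Euc n) :
    fderiv ℝ (fun w => form (f w) (g w)) u v =
      form (fderiv ℝ f u v) (g u) + form (f u) (fderiv ℝ g u v) := by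
  have := ((formL n).hasFDerivAt_of_bilinear hf.hasFDerivAt hg.hasFDerivAt).fderiv
  simp only [formL_apply] at this
  rw [this]
  simp [formL_apply, add_comm]

theorem contDiffOn_form {f g : Euc n → LSpace n} {O : Set (Euc n)} (hf : ContDiffOn ℝ ∞ f O)
    (hg : ContDiffOn ℝ ∞ g O) : ContDiffOn ℝ ∞ (fun w => form (f w) (g w)) O :=
  ((formL n).contDiff.comp_contDiffOn hf).clm_apply hg

end Form

/-! ### Derivatives along vector fields -/

section DirectionalDerivative

variable {n : ℕ} {F : Type*} [NormedAddCommGroup F] [NormedSpace ℝ F]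

/-- The derivative of `f` along the vector field `V`. -/
def dirDeriv (V : Euc n → Euc n) (f : Euc n → F) (u : Euc n) : F := fderiv ℝ f u (V u)

/-- The commutator of two vector fields. -/
def commutator (V W : Euc n → Euc n) (u : Euc n) : Euc n :=
  dirDeriv V W u - dirDeriv W V u

variable {O : Set (Euc n)} {u : Euc n}

theorem differentiableAt_of_contDiffOn {f : Euc n → F} (hO : IsOpen O) (hf : ContDiffOn ℝ ∞ f O)
    (hu : u ∈ O) : DifferentiableAt ℝ f u :=
  (hf.contDiffAt (hO.mem_nhds hu)).differentiableAt (by simp)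

theorem contDiffOn_fderiv {f : Euc n → F} (hO : IsOpen O) (hf : ContDiffOn ℝ ∞ f O) :
    ContDiffOn ℝ ∞ (fderiv ℝ f) O :=
  hf.fderiv_of_isOpen hO (by simp)

theorem contDiffOn_dirDeriv {V : Euc n → Euc n} {f : Euc n → F} (hO : IsOpen O)
    (hV : ContDiffOn ℝ ∞ V O) (hf : ContDiffOn ℝ ∞ f O) : ContDiffOn ℝ ∞ (dirDeriv V f) O :=
  (contDiffOn_fderiv hO hf).clm_apply hV

theorem dirDeriv_dirDeriv {V W : Euc n → Euc n} {f : Euc n → F} (hO : IsOpen O)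
    (hW : ContDiffOn ℝ ∞ W O) (hf : ContDiffOn ℝ ∞ f O) (hu : u ∈ O) :
    dirDeriv V (dirDeriv W f) u =
      fderiv ℝ (fderiv ℝ f) u (V u) (W u) + fderiv ℝ f u (dirDeriv V W u) := by
  unfold dirDeriv
  rw [fderiv_clm_apply (differentiableAt_of_contDiffOn hO (contDiffOn_fderiv hO hf) hu)
    (differentiableAt_of_contDiffOn hO hW hu)]
  simp [add_comm]

theorem fderiv_fderiv_symm {f : Euc n → F} (hO : IsOpen O) (hf : ContDiffOn ℝ ∞ f O) (hu : u ∈ O)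
    (v w : Euc n) : fderiv ℝ (fderiv ℝ f) u v w = fderiv ℝ (fderiv ℝ f) u w v :=
  (hf.contDiffAt (hO.mem_nhds hu)).isSymmSndFDerivAt
    (by rw [minSmoothness_of_isRCLikeNormedField]; exact WithTop.coe_le_coe.2 (le_top : (2 : ℕ∞) ≤ ⊤)) v w

/-- The second derivative of `f` is symmetric, so only the derivatives of the fields survive. -/
theorem dirDeriv_comm {V W : Euc n → Euc n} {f : Euc n → F} (hO : IsOpen O)
    (hV : ContDiffOn ℝ ∞ V O) (hW : ContDiffOn ℝ ∞ W O) (hf : ContDiffOn ℝ ∞ f O) (hu : u ∈ O) :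
    dirDeriv V (dirDeriv W f) u - dirDeriv W (dirDeriv V f) u =
      fderiv ℝ f u (commutator V W u) := by
  rw [dirDeriv_dirDeriv hO hW hf hu, dirDeriv_dirDeriv hO hV hf hu,
    fderiv_fderiv_symm hO hf hu (V u) (W u), commutator, map_sub]
  abel

theorem dirDeriv_congr {V : Euc n → Euc n} {f g : Euc n → F} (hO : IsOpen O)
    (h : ∀ w ∈ O, f w = g w) (hu : u ∈ O) : dirDeriv V f u = dirDeriv V g u := by
  unfold dirDeriv
  rw [Filter.EventuallyEq.fderiv_eq (Filter.eventuallyEq_of_mem (hO.mem_nhds hu) h)]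

theorem dirDeriv_form {V : Euc n → Euc n} {f g : Euc n → LSpace n} (hO : IsOpen O)
    (hf : ContDiffOn ℝ ∞ f O) (hg : ContDiffOn ℝ ∞ g O) (hu : u ∈ O) :
    dirDeriv V (fun w => form (f w) (g w)) u =
      form (dirDeriv V f u) (g u) + form (f u) (dirDeriv V g u) :=
  fderiv_form (differentiableAt_of_contDiffOn hO hf hu) (differentiableAt_of_contDiffOn hO hg hu) _

end DirectionalDerivative

/-! ### Cartan's identity and its sign consequences -/

section Isoparametric

variable {n : ℕ}

/-- The algebra behind Cartan's identity: `t i j k` are connection coefficients in a frame of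
eigenvectors of a Codazzi tensor with constant eigenvalues `μ`. -/
theorem connection_sum_eq {μ : Fin n → ℝ} {t : Fin n → Fin n → Fin n → ℝ}
    (hc : ∀ i j k, (μ j - μ k) * t i j k = (μ i - μ k) * t j i k)
    (ha : ∀ i j k, μ j ≠ μ k → t i j k = -t i k j) {i k : Fin n} (hik : μ i ≠ μ k) :
    -∑ j, t k k j * t i i j + ∑ j, t i k j * t k i j - ∑ j, (t i k j - t k i j) * t j k i =
      2 * ∑ j, ((μ k - μ j) * t i k j) ^ 2 / ((μ k - μ j) * (μ i - μ j)) := by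
  rw [← Finset.sum_neg_distrib, ← Finset.sum_add_distrib, ← Finset.sum_sub_distrib,
    Finset.mul_sum]
  refine Finset.sum_congr rfl fun j _ => ?_
  have hik' : μ i - μ k ≠ 0 := sub_ne_zero.2 hik
  have hki' : μ k - μ i ≠ 0 := sub_ne_zero.2 hik.symm
  by_cases hjk : μ j = μ k
  -- When $\mu_j$ equals $\mu_k$ or $\mu_i$, the denominator on the right is zero and the quotient
  -- is $0$ by convention; on the left each product has a vanishing factor.
  · have h1 : t k i j = 0 := by
      have := hc i k j
      rw [hjk, sub_self, zero_mul] at this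
      exact (mul_eq_zero.1 this.symm).resolve_left hik'
    have h2 : t j k i = 0 := by
      have h3 := hc j i k
      rw [hjk, sub_self, zero_mul] at h3
      rw [ha j k i hik.symm, (mul_eq_zero.1 h3).resolve_left hik', neg_zero]
    have h4 : t i i j = 0 := by
      have hij : μ i ≠ μ j := by rwa [hjk]
      have h3 := hc i j i
      rw [sub_self, zero_mul] at h3
      rw [ha i i j hij, (mul_eq_zero.1 h3).resolve_left (sub_ne_zero.2 hij.symm), neg_zero]
    rw [h1, h2, h4, hjk]
    simp
  · by_cases hji : μ j = μ i
    · have h1 : t i k j = 0 := by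
        have := hc i k j
        rw [hji, sub_self, zero_mul] at this
        exact (mul_eq_zero.1 this).resolve_left hki'
      have h2 : t j k i = 0 := by
        have h3 := hc j k i
        rw [hji, sub_self, zero_mul] at h3
        exact (mul_eq_zero.1 h3).resolve_left hki'
      have h4 : t k k j = 0 := by
        have h3 := hc k j k
        rw [sub_self, zero_mul] at h3
        rw [ha k k j (Ne.symm hjk), (mul_eq_zero.1 h3).resolve_left (sub_ne_zero.2 hjk), neg_zero]
      rw [h1, h2, h4, hji]
      simp
    · have h4 : t k k j = 0 := by
        have h3 := hc k j k
        rw [sub_self, zero_mul] at h3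
        rw [ha k k j (Ne.symm hjk), (mul_eq_zero.1 h3).resolve_left (sub_ne_zero.2 hjk), neg_zero]
      have hkj : μ k - μ j ≠ 0 := sub_ne_zero.2 (Ne.symm hjk)
      have hij : μ i - μ j ≠ 0 := sub_ne_zero.2 (Ne.symm hji)
      -- For three distinct eigenvalues, all coefficients involved are multiples of the single
      -- number $(\mu_k-\mu_j)\,t_{ikj}$.
      have h5 : t k i j = (μ k - μ j) * t i k j / (μ i - μ j) := by
        rw [hc i k j]; field_simp
      have h6 : t j k i = (μ k - μ j) * t i k j / (μ k - μ i) := by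
        rw [eq_div_iff hki', hc i k j]
        have := hc j k i
        rw [ha k j i hji] at this
        linarith
      rw [h4, h5, h6]
      field_simp
      ring

/-- Cartan's identity for a pair `Y`, `η` whose differentials are related by an endomorphism with
constant eigenvalues `μ`, diagonalized by the vector fields `V`. -/
theorem cartan_identity {O : Set (Euc n)} (hO : IsOpen O) {u : Euc n} (hu : u ∈ O)
    {Y η : Euc n → LSpace n} (hY : ContDiffOn ℝ ∞ Y O) (hη : ContDiffOn ℝ ∞ η O)
    {V : Fin n → Euc n → Euc n} (hV : ∀ j, ContDiffOn ℝ ∞ (V j) O) {μ : Fin n → ℝ}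
    (h1 : ∀ w ∈ O, ∀ j, dirDeriv (V j) η w = μ j • dirDeriv (V j) Y w)
    (h2 : ∀ w ∈ O, ∀ v k, form (fderiv ℝ η w v) (dirDeriv (V k) Y w) =
      μ k * form (fderiv ℝ Y w v) (dirDeriv (V k) Y w))
    (horth : ∀ i j, form (dirDeriv (V i) Y u) (dirDeriv (V j) Y u) = if i = j then 1 else 0)
    (hspan : ∀ v : Euc n, v = ∑ j, form (fderiv ℝ Y u v) (dirDeriv (V j) Y u) • V j u)
    {lam : ℝ}
    (hgauss : ∀ v w z v' w' z' : Euc n,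
      form (fderiv ℝ (fderiv ℝ Y) u v w + fderiv ℝ Y u z)
        (fderiv ℝ (fderiv ℝ Y) u v' w' + fderiv ℝ Y u z') =
      ∑ j, form (fderiv ℝ (fderiv ℝ Y) u v w + fderiv ℝ Y u z) (dirDeriv (V j) Y u) *
        form (fderiv ℝ (fderiv ℝ Y) u v' w' + fderiv ℝ Y u z') (dirDeriv (V j) Y u) -
      2 * lam * form (fderiv ℝ Y u v) (fderiv ℝ Y u w) *
        form (fderiv ℝ Y u v') (fderiv ℝ Y u w'))
    {i k : Fin n} (hik : μ i ≠ μ k) :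
    ∃ τ : Fin n → ℝ, lam = -∑ j, τ j ^ 2 / ((μ k - μ j) * (μ i - μ j)) := by
  set t : Fin n → Fin n → Fin n → Euc n → ℝ :=
    fun i j k w => form (dirDeriv (V i) (dirDeriv (V j) Y) w) (dirDeriv (V k) Y w) with ht
  have hX : ∀ j, ContDiffOn ℝ ∞ (dirDeriv (V j) Y) O := fun j => contDiffOn_dirDeriv hO (hV j) hY
  have hXX : ∀ i j, ContDiffOn ℝ ∞ (dirDeriv (V i) (dirDeriv (V j) Y)) O :=
    fun i j => contDiffOn_dirDeriv hO (hV i) (hX j)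
  -- The Codazzi equation: pair $V_iV_j\eta-V_jV_i\eta=d\eta([V_i,V_j])$ with $V_kY$. Constancy of
  -- the $\mu_j$ is what gives $V_iV_j\eta=\mu_jV_iV_jY$.
  have hc : ∀ w ∈ O, ∀ i j k, (μ j - μ k) * t i j k w = (μ i - μ k) * t j i k w := by
    intro w hw i j k
    have e1 : ∀ i j, dirDeriv (V i) (dirDeriv (V j) η) w =
        μ j • dirDeriv (V i) (dirDeriv (V j) Y) w := by
      intro i j
      rw [dirDeriv_congr hO (fun w hw => h1 w hw j) hw, dirDeriv,
        fderiv_fun_const_smul (differentiableAt_of_contDiffOn hO (hX j) hw)]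
      rfl
    have e2 := dirDeriv_comm hO (hV i) (hV j) hη hw
    have e3 := dirDeriv_comm hO (hV i) (hV j) hY hw
    have e4 := h2 w hw (commutator (V i) (V j) w) k
    rw [← e2, ← e3, e1, e1, form_sub_left, form_sub_left, form_smul_left, form_smul_left] at e4
    simp only [ht]
    linarith
  -- The frame is orthonormal only at `u`. On all of `O`, only fields with distinct eigenvalues are
  -- known to be orthogonal, hence the restriction in `ha`.
  have hort : ∀ w ∈ O, ∀ j k, μ j ≠ μ k → form (dirDeriv (V j) Y w) (dirDeriv (V k) Y w) = 0 := by
    intro w hw j k hjk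
    have e := h2 w hw (V j w) k
    change form (dirDeriv (V j) η w) _ = μ k * form (dirDeriv (V j) Y w) _ at e
    rw [h1 w hw j, form_smul_left] at e
    have : (μ j - μ k) * form (dirDeriv (V j) Y w) (dirDeriv (V k) Y w) = 0 := by linarith
    exact (mul_eq_zero.1 this).resolve_left (sub_ne_zero.2 hjk)
  have hzero : ∀ (f : Euc n → ℝ), (∀ w ∈ O, f w = 0) → ∀ (W : Euc n → Euc n), ∀ w ∈ O,
      dirDeriv W f w = 0 := by
    intro f hf W w hw
    rw [dirDeriv_congr (g := fun _ => 0) hO hf hw]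
    simp [dirDeriv]
  have ha : ∀ w ∈ O, ∀ i j k, μ j ≠ μ k → t i j k w = -t i k j w := by
    intro w hw i j k hjk
    have e := hzero _ (fun w hw => hort w hw j k hjk) (V i) w hw
    rw [dirDeriv_form hO (hX j) (hX k) hw, form_comm (dirDeriv (V j) Y w)] at e
    simp only [ht]
    linarith
  -- These two coefficients vanish identically on `O`, so they may be differentiated, along $V_i$
  -- and $V_k$ respectively. The difference of the results contains the commutator of third
  -- derivatives of $Y$.
  have hkki : ∀ w ∈ O, t k k i w = 0 := by
    intro w hw
    have h3 := hc w hw k i k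
    rw [sub_self, zero_mul] at h3
    rw [ha w hw k k i hik.symm, (mul_eq_zero.1 h3).resolve_left (sub_ne_zero.2 hik), neg_zero]
  have hiki : ∀ w ∈ O, t i k i w = 0 := by
    intro w hw
    have h3 := hc w hw i k i
    rw [sub_self, zero_mul] at h3
    exact (mul_eq_zero.1 h3).resolve_left (sub_ne_zero.2 hik.symm)
  have f1 := hzero _ hkki (V i) u hu
  have f2 := hzero _ hiki (V k) u hu
  simp only [ht] at f1 f2
  rw [dirDeriv_form hO (hXX k k) (hX i) hu] at f1
  rw [dirDeriv_form hO (hXX i k) (hX i) hu] at f2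
  have f3 := dirDeriv_comm hO (hV i) (hV k) (hX k) hu
  have f4 : form (fderiv ℝ (dirDeriv (V k) Y) u (commutator (V i) (V k) u)) (dirDeriv (V i) Y u) =
      ∑ j, (t i k j u - t k i j u) * t j k i u := by
    have e3 := dirDeriv_comm hO (hV i) (hV k) hY hu
    rw [hspan (commutator (V i) (V k) u), ← e3, map_sum, form_sum_left]
    refine Finset.sum_congr rfl fun j _ => ?_
    rw [map_smul, form_smul_left, form_sub_left]
    rfl
  -- The Gauss identity brings in $\lambda$ here, as $\langle V_kY,V_kY\rangle\langle
  -- V_iY,V_iY\rangle=1$. In `g2` the $\lambda$-term drops out since $V_iY\perp V_kY$.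
  have g1 : form (dirDeriv (V k) (dirDeriv (V k) Y) u) (dirDeriv (V i) (dirDeriv (V i) Y) u) =
      ∑ j, t k k j u * t i i j u - 2 * lam := by
    simp only [ht]
    rw [dirDeriv_dirDeriv hO (hV k) hY hu, dirDeriv_dirDeriv hO (hV i) hY hu, hgauss]
    have e1 := horth k k
    have e2 := horth i i
    rw [if_pos rfl] at e1 e2
    unfold dirDeriv at e1 e2
    rw [e1, e2, mul_one, mul_one]
  have g2 : form (dirDeriv (V i) (dirDeriv (V k) Y) u) (dirDeriv (V k) (dirDeriv (V i) Y) u) =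
      ∑ j, t i k j u * t k i j u := by
    simp only [ht]
    rw [dirDeriv_dirDeriv hO (hV k) hY hu, dirDeriv_dirDeriv hO (hV i) hY hu, hgauss]
    have e1 := hort u hu i k hik
    unfold dirDeriv at e1
    rw [e1, mul_zero, zero_mul, sub_zero]
  have key := connection_sum_eq (t := fun i j k => t i j k u) (hc u hu) (ha u hu) hik
  refine ⟨fun j => (μ k - μ j) * t i k j u, ?_⟩
  rw [← f4, ← f3, form_sub_left] at key
  beta_reduce at key ⊢
  linarith


/-- Cartan's identity for all pairs of distinct eigenvalues forces the curvature to vanish. -/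
theorem eq_zero_of_cartan_identity {μ : Fin n → ℝ} {lam : ℝ} (hne : ∃ i k, μ i ≠ μ k)
    (h : ∀ i k, μ i ≠ μ k →
      ∃ τ : Fin n → ℝ, lam = -∑ j, τ j ^ 2 / ((μ k - μ j) * (μ i - μ j))) : lam = 0 := by
  obtain ⟨i₀, k₀, hik₀⟩ := hne
  have : Nonempty (Fin n) := ⟨i₀⟩
  obtain ⟨i, hi⟩ := Finite.exists_max μ
  obtain ⟨m, hm⟩ := Finite.exists_min μ
  have him : μ m < μ i := by
    rcases lt_or_gt_of_ne hik₀ with h' | h'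
    · exact (hm _).trans_lt (h'.trans_le (hi _))
    · exact (hm _).trans_lt (h'.trans_le (hi _))
  -- The value $\mu_k$ is the largest one below the maximum $\mu_i$, so no $\mu_j$ lies strictly
  -- between them.
  obtain ⟨k, hk, hkmax⟩ := Finset.exists_max_image (Finset.univ.filter fun j => μ j < μ i) μ
    ⟨m, by simpa using him⟩
  have hk' : μ k < μ i := by simpa using hk
  apply le_antisymm
  · obtain ⟨τ, hτ⟩ := h i k hk'.ne'
    rw [hτ, neg_nonpos]
    refine Finset.sum_nonneg fun j _ => div_nonneg (sq_nonneg _) ?_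
    by_cases hj : μ j < μ i
    · exact mul_nonneg (sub_nonneg.2 (hkmax j (by simpa using hj))) (sub_nonneg.2 (hi j))
    · rw [le_antisymm (hi j) (not_lt.1 hj), sub_self, mul_zero]
  · obtain ⟨τ, hτ⟩ := h i m him.ne'
    rw [hτ, ← Finset.sum_neg_distrib]
    refine Finset.sum_nonneg fun j _ => neg_nonneg.2 (div_nonpos_of_nonneg_of_nonpos (sq_nonneg _) ?_)
    exact mul_nonpos_of_nonpos_of_nonneg (sub_nonpos.2 (hm j)) (sub_nonneg.2 (hi j))

end Isoparametric

/-! ### Smoothness of matrix-valued functions -/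

section MatrixSmoothness

open Matrix Polynomial

variable {n : ℕ} {O : Set (Euc n)}

/-- A matrix-valued function has smooth entries on `O`. -/
def SmoothEntries (M : Euc n → Matrix (Fin n) (Fin n) ℝ) (O : Set (Euc n)) : Prop :=
  ∀ a b, ContDiffOn ℝ ∞ (fun u => M u a b) O

theorem SmoothEntries.mul {M N : Euc n → Matrix (Fin n) (Fin n) ℝ} (hM : SmoothEntries M O)
    (hN : SmoothEntries N O) : SmoothEntries (fun u => M u * N u) O := fun a b => by
  simp only [Matrix.mul_apply]
  exact ContDiffOn.sum fun c _ => (hM a c).mul (hN c b)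

theorem SmoothEntries.add {M N : Euc n → Matrix (Fin n) (Fin n) ℝ} (hM : SmoothEntries M O)
    (hN : SmoothEntries N O) : SmoothEntries (fun u => M u + N u) O :=
  fun a b => (hM a b).add (hN a b)

theorem SmoothEntries.sub {M N : Euc n → Matrix (Fin n) (Fin n) ℝ} (hM : SmoothEntries M O)
    (hN : SmoothEntries N O) : SmoothEntries (fun u => M u - N u) O :=
  fun a b => (hM a b).sub (hN a b)

theorem SmoothEntries.smul {f : Euc n → ℝ} {M : Euc n → Matrix (Fin n) (Fin n) ℝ}
    (hf : ContDiffOn ℝ ∞ f O) (hM : SmoothEntries M O) : SmoothEntries (fun u => f u • M u) O :=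
  fun a b => hf.mul (hM a b)

theorem smoothEntries_const (M : Matrix (Fin n) (Fin n) ℝ) : SmoothEntries (fun _ => M) O :=
  fun _ _ => contDiffOn_const

theorem SmoothEntries.det {M : Euc n → Matrix (Fin n) (Fin n) ℝ} (hM : SmoothEntries M O) :
    ContDiffOn ℝ ∞ (fun u => (M u).det) O := by
  simp only [Matrix.det_apply']
  exact ContDiffOn.sum fun σ _ => contDiffOn_const.mul (contDiffOn_prod fun i _ => hM _ _)

theorem SmoothEntries.trace {M : Euc n → Matrix (Fin n) (Fin n) ℝ} (hM : SmoothEntries M O) :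
    ContDiffOn ℝ ∞ (fun u => (M u).trace) O :=
  ContDiffOn.sum fun a _ => hM a a

/-- By Cramer's rule the entries of the inverse are determinants divided by $\det M$. -/
theorem SmoothEntries.inv {M : Euc n → Matrix (Fin n) (Fin n) ℝ} (hM : SmoothEntries M O)
    (h : ∀ u ∈ O, (M u).det ≠ 0) : SmoothEntries (fun u => (M u)⁻¹) O := fun a b => by
  simp only [Matrix.inv_def, Ring.inverse_eq_inv', Matrix.smul_apply, smul_eq_mul,
    Matrix.adjugate_apply]
  refine (hM.det.inv h).mul (SmoothEntries.det fun i j => ?_)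
  by_cases hi : i = b
  · subst hi
    simpa using contDiffOn_const
  · simpa [Matrix.updateRow_ne hi] using hM i j

theorem SmoothEntries.aeval {M : Euc n → Matrix (Fin n) (Fin n) ℝ} (hM : SmoothEntries M O)
    (p : ℝ[X]) : SmoothEntries (fun u => Polynomial.aeval (M u) p) O := by
  induction p using Polynomial.induction_on' with
  | add p q hp hq => simpa using hp.add hq
  | monomial k c =>
    have : ∀ k : ℕ, SmoothEntries (fun u => M u ^ k) O := by
      intro k
      induction k with
      | zero => simpa using smoothEntries_const 1
      | succ k ih => simpa [pow_succ] using ih.mul hM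
    simp only [aeval_monomial]
    exact (smoothEntries_const _).mul (this k)

end MatrixSmoothness

/-! ### Partial derivatives in coordinates -/

section PartialDerivatives

variable {n : ℕ} {F : Type*} [NormedAddCommGroup F] [NormedSpace ℝ F] {O : Set (Euc n)}
  {u : Euc n}

theorem contDiffOn_pd {f : Euc n → F} (hO : IsOpen O) (hf : ContDiffOn ℝ ∞ f O) (a : Fin n) :
    ContDiffOn ℝ ∞ (pd a f) O :=
  (contDiffOn_fderiv hO hf).clm_apply contDiffOn_const

theorem pd_congr {f g : Euc n → F} (hO : IsOpen O) (h : ∀ w ∈ O, f w = g w) (hu : u ∈ O)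
    (a : Fin n) : pd a f u = pd a g u :=
  dirDeriv_congr (V := fun _ => EuclideanSpace.single a 1) hO h hu

theorem pd_const (a : Fin n) (c : F) (u : Euc n) : pd a (fun _ => c) u = 0 := by
  simp [pd]

theorem pd_pd {f : Euc n → F} (hO : IsOpen O) (hf : ContDiffOn ℝ ∞ f O) (hu : u ∈ O)
    (a b : Fin n) : pd a (pd b f) u =
      fderiv ℝ (fderiv ℝ f) u (EuclideanSpace.single a 1) (EuclideanSpace.single b 1) := by
  have := dirDeriv_dirDeriv (V := fun _ => EuclideanSpace.single a 1)
    (W := fun _ => EuclideanSpace.single b 1) hO contDiffOn_const hf hu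
  exact this.trans (by simp [dirDeriv])

theorem pd_comm {f : Euc n → F} (hO : IsOpen O) (hf : ContDiffOn ℝ ∞ f O) (hu : u ∈ O)
    (a b : Fin n) : pd a (pd b f) u = pd b (pd a f) u := by
  rw [pd_pd hO hf hu, pd_pd hO hf hu, fderiv_fderiv_symm hO hf hu]

theorem pd_smul {c : Euc n → ℝ} {f : Euc n → F} (hO : IsOpen O) (hc : ContDiffOn ℝ ∞ c O)
    (hf : ContDiffOn ℝ ∞ f O) (hu : u ∈ O) (a : Fin n) :
    pd a (fun w => c w • f w) u = pd a c u • f u + c u • pd a f u := by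
  unfold pd
  rw [fderiv_fun_smul (differentiableAt_of_contDiffOn hO hc hu)
    (differentiableAt_of_contDiffOn hO hf hu)]
  simp [add_comm]

theorem pd_form {f g : Euc n → LSpace n} (hO : IsOpen O) (hf : ContDiffOn ℝ ∞ f O)
    (hg : ContDiffOn ℝ ∞ g O) (hu : u ∈ O) (a : Fin n) :
    pd a (fun w => form (f w) (g w)) u = form (pd a f u) (g u) + form (f u) (pd a g u) :=
  fderiv_form (differentiableAt_of_contDiffOn hO hf hu) (differentiableAt_of_contDiffOn hO hg hu) _

theorem pd_inner {E : Type*} [NormedAddCommGroup E] [InnerProductSpace ℝ E] {f g : Euc n → E}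
    (hO : IsOpen O) (hf : ContDiffOn ℝ ∞ f O) (hg : ContDiffOn ℝ ∞ g O) (hu : u ∈ O)
    (a : Fin n) :
    pd a (fun w => inner ℝ (f w) (g w)) u =
      inner ℝ (pd a f u) (g u) + inner ℝ (f u) (pd a g u) := by
  unfold pd
  rw [fderiv_inner_apply ℝ (differentiableAt_of_contDiffOn hO hf hu)
    (differentiableAt_of_contDiffOn hO hg hu), add_comm]

theorem fderiv_eq_sum_pd (f : Euc n → F) (u v : Euc n) :
    fderiv ℝ f u v = ∑ a, v a • pd a f u := by
  conv_lhs => rw [← (EuclideanSpace.basisFun (Fin n) ℝ).sum_repr v]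
  simp [pd]

end PartialDerivatives

/-- A parametrized oriented hypersurface without umbilics and with nonvanishing principal
curvatures. -/
structure IsLocalHypersurface {n : ℕ} (x ξ : Euc n → Euc (n + 1)) (O : Set (Euc n)) : Prop where
  isOpen : IsOpen O
  smooth : ContDiffOn ℝ ∞ x O
  smooth_normal : ContDiffOn ℝ ∞ ξ O
  unit : ∀ u ∈ O, inner ℝ (ξ u) (ξ u) = (1 : ℝ)
  normal : ∀ u ∈ O, ∀ a, inner ℝ (pd a x u) (ξ u) = (0 : ℝ)
  immersion : ∀ u ∈ O, LinearIndependent ℝ fun a => pd a x u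
  nonvanishing : ∀ u ∈ O, 0 ∉ principalCurvatures x ξ u
  umbilicFree : ∀ u ∈ O, ¬ ∃ k : ℝ, ∀ k' ∈ principalCurvatures x ξ u, k' = k

/-! ### Fundamental forms and curvature radii -/

namespace IsLocalHypersurface

open Matrix

variable {n : ℕ} {x ξ : Euc n → Euc (n + 1)} {O : Set (Euc n)} (H : IsLocalHypersurface x ξ O)
  {u : Euc n} (hu : u ∈ O)
include H hu

theorem inner_pd_normal (a : Fin n) : inner ℝ (pd a ξ u) (ξ u) = (0 : ℝ) := by
  have h := pd_congr H.isOpen H.unit hu a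
  rw [pd_inner H.isOpen H.smooth_normal H.smooth_normal hu, pd_const,
    real_inner_comm (pd a ξ u) (ξ u)] at h
  linarith

/-- Obtained by differentiating $\partial_ax\cdot\xi=0$; in this form the symmetry of the second
fundamental form is visible. -/
theorem secondForm_apply (a b : Fin n) :
    secondForm x ξ u a b = inner ℝ (pd b (pd a x) u) (ξ u) := by
  have h := pd_congr H.isOpen (fun w hw => H.normal w hw a) hu b
  rw [pd_inner H.isOpen (contDiffOn_pd H.isOpen H.smooth a) H.smooth_normal hu, pd_const] at h
  rw [secondForm, of_apply]
  linarith

theorem secondForm_transpose : (secondForm x ξ u)ᵀ = secondForm x ξ u := by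
  ext a b
  rw [transpose_apply, H.secondForm_apply hu, H.secondForm_apply hu,
    pd_comm H.isOpen H.smooth hu]

theorem firstForm_posDef : (firstForm x u).PosDef :=
  posDef_gram_iff_linearIndependent.2 (H.immersion u hu)

theorem eq_zero_of_inner_eq_zero {w : Euc (n + 1)} (h : ∀ a, inner ℝ (pd a x u) w = (0 : ℝ))
    (hξ : inner ℝ w (ξ u) = (0 : ℝ)) : w = 0 := by
  set K := Submodule.span ℝ (Set.range fun a => pd a x u) with hK
  have hfin : Module.finrank ℝ K = n := by
    rw [hK, finrank_span_eq_card (H.immersion u hu), Fintype.card_fin]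
  -- The tangent space has codimension one, so its orthogonal complement is the line spanned by
  -- $\xi$.
  have hfin' : Module.finrank ℝ Kᗮ = 1 := by
    have := K.finrank_add_finrank_orthogonal
    rw [hfin, finrank_euclideanSpace_fin] at this
    omega
  have hmem : ∀ z : Euc (n + 1), (∀ a, inner ℝ (pd a x u) z = (0 : ℝ)) → z ∈ Kᗮ := by
    intro z hz
    rw [Submodule.mem_orthogonal]
    intro y hy
    induction hy using Submodule.span_induction with
    | mem y hy => obtain ⟨a, rfl⟩ := hy; exact hz a
    | zero => simp
    | add y y' _ _ h h' => rw [inner_add_left, h, h', add_zero]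
    | smul c y _ h => rw [real_inner_smul_left, h, mul_zero]
  have hne : (⟨ξ u, hmem _ (H.normal u hu)⟩ : Kᗮ) ≠ 0 := by
    intro h0
    have h1 : ξ u = 0 := congrArg Subtype.val h0
    have h2 := H.unit u hu
    rw [h1] at h2
    simp at h2
  obtain ⟨c, hc⟩ := (finrank_eq_one_iff_of_nonzero' _ hne).1 hfin' ⟨w, hmem w h⟩
  have hcw : c • ξ u = w := congrArg Subtype.val hc
  rw [← hcw, real_inner_smul_left, H.unit u hu, mul_one] at hξ
  rw [← hcw, hξ, zero_smul]

theorem eq_sum_of_inner_normal_eq_zero {w : Euc (n + 1)} (hw : inner ℝ w (ξ u) = (0 : ℝ)) :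
    w = ∑ c, (∑ d, (firstForm x u)⁻¹ c d * inner ℝ (pd d x u) w) • pd c x u := by
  rw [← sub_eq_zero]
  refine H.eq_zero_of_inner_eq_zero hu (fun a => ?_) ?_
  · rw [inner_sub_right, inner_sum]
    simp only [real_inner_smul_right]
    have h1 : firstForm x u *ᵥ ((firstForm x u)⁻¹ *ᵥ fun d => inner ℝ (pd d x u) w) =
        fun d => inner ℝ (pd d x u) w := by
      rw [mulVec_mulVec, mul_nonsing_inv _ ((isUnit_iff_isUnit_det _).1
        (H.firstForm_posDef hu).isUnit), one_mulVec]
    have h2 := congrFun h1 a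
    simp only [mulVec, dotProduct] at h2
    rw [sub_eq_zero, ← h2]
    refine Finset.sum_congr rfl fun c _ => ?_
    rw [mul_comm]
    rfl
  · rw [inner_sub_left, hw, sum_inner]
    simp [real_inner_smul_left, H.normal u hu]

/-- The derivatives of $\xi$ are tangent to the hypersurface, so they can be expanded in the
$\partial_cx$ (the Weingarten formula). -/
theorem thirdForm_eq :
    thirdForm ξ u = secondForm x ξ u * (firstForm x u)⁻¹ * secondForm x ξ u := by
  ext a b
  rw [thirdForm, of_apply]
  conv_lhs => rw [H.eq_sum_of_inner_normal_eq_zero hu (H.inner_pd_normal hu b)]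
  rw [inner_sum, Matrix.mul_assoc, Matrix.mul_apply]
  refine Finset.sum_congr rfl fun c _ => ?_
  have h1 : secondForm x ξ u a c = -inner ℝ (pd c x u) (pd a ξ u) := by
    rw [← H.secondForm_transpose hu]; rfl
  rw [real_inner_smul_right, Matrix.mul_apply, h1, real_inner_comm (pd c x u)]
  have h2 : ∑ d, (firstForm x u)⁻¹ c d * secondForm x ξ u d b =
      -∑ d, (firstForm x u)⁻¹ c d * inner ℝ (pd d x u) (pd b ξ u) := by
    rw [← Finset.sum_neg_distrib]
    exact Finset.sum_congr rfl fun d _ => mul_neg _ _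
  rw [h2, real_inner_comm]
  ring

/-- A frame diagonalizing the second fundamental form relative to the third one; the eigenvalues
are the curvature radii. -/
theorem exists_radii_frame :
    ∃ (Q : Matrix (Fin n) (Fin n) ℝ) (s : Fin n → ℝ), Qᵀ * thirdForm ξ u * Q = 1 ∧
      Qᵀ * secondForm x ξ u * Q = diagonal s ∧ radii x ξ u = Finset.univ.val.map s ∧
      ∃ i k, s i ≠ s k := by
  obtain ⟨Q, d, h, hd⟩ := exists_simultaneous_diagonalization (H.firstForm_posDef hu)
    (H.secondForm_transpose hu)
  have hpc : principalCurvatures x ξ u = Finset.univ.val.map d := eigenvaluesRel_eq h hd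
  have hd0 : ∀ i, d i ≠ 0 := by
    intro i hi
    apply H.nonvanishing u hu
    rw [hpc, ← hi]
    exact Multiset.mem_map_of_mem d (Finset.mem_univ_val i)
  have h3 : Qᵀ * thirdForm ξ u * Q = diagonal d * diagonal d := by
    rw [H.thirdForm_eq hu, inv_eq_mul_transpose h, ← hd]
    simp only [Matrix.mul_assoc]
  have hinv : diagonal d * diagonal (fun i => 1 / d i) = 1 := by
    rw [diagonal_mul_diagonal, ← diagonal_one]
    congr 1
    ext i
    exact mul_one_div_cancel (hd0 i)
  have hinv' : diagonal (fun i => 1 / d i) * diagonal d = 1 := mul_eq_one_comm.1 hinv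
  -- In the principal frame `Q` the three forms are $1$, $\mathrm{diag}(k_i)$ and
  -- $\mathrm{diag}(k_i^2)$; dividing the $i$-th vector by $k_i$ makes the third one $1$ and the
  -- second one $\mathrm{diag}(1/k_i)$.
  refine ⟨Q * diagonal (fun i => 1 / d i), fun i => 1 / d i, ?_, ?_, ?_, ?_⟩
  · calc _ = diagonal (fun i => 1 / d i) * (Qᵀ * thirdForm ξ u * Q) *
          diagonal (fun i => 1 / d i) := by
          rw [transpose_mul, diagonal_transpose]; simp only [Matrix.mul_assoc]
      _ = (diagonal (fun i => 1 / d i) * diagonal d) *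
          (diagonal d * diagonal (fun i => 1 / d i)) := by
          rw [h3]; simp only [Matrix.mul_assoc]
      _ = 1 := by rw [hinv, hinv', Matrix.one_mul]
  · calc _ = diagonal (fun i => 1 / d i) * (Qᵀ * secondForm x ξ u * Q) *
          diagonal (fun i => 1 / d i) := by
          rw [transpose_mul, diagonal_transpose]; simp only [Matrix.mul_assoc]
      _ = _ := by rw [hd, hinv', Matrix.one_mul]
  · rw [radii, hpc, Multiset.map_map]
    rfl
  · by_contra hcon
    push Not at hcon
    apply H.umbilicFree u hu
    rcases isEmpty_or_nonempty (Fin n) with hE | ⟨⟨i₀⟩⟩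
    · exact ⟨0, fun k' hk' => by
        rw [hpc] at hk'
        obtain ⟨i, -, -⟩ := Multiset.mem_map.1 hk'
        exact hE.elim i⟩
    · refine ⟨d i₀, fun k' hk' => ?_⟩
      rw [hpc] at hk'
      obtain ⟨i, -, rfl⟩ := Multiset.mem_map.1 hk'
      have := hcon i i₀
      simpa using this

end IsLocalHypersurface

/-! ### Derivatives of tuples and sums -/

section ProductDerivatives

variable {n : ℕ} {F F' : Type*} [NormedAddCommGroup F] [NormedSpace ℝ F] [NormedAddCommGroup F']
  [NormedSpace ℝ F'] {O : Set (Euc n)} {u : Euc n}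

theorem pd_prodMk {f : Euc n → F} {g : Euc n → F'} (hO : IsOpen O) (hf : ContDiffOn ℝ ∞ f O)
    (hg : ContDiffOn ℝ ∞ g O) (hu : u ∈ O) (a : Fin n) :
    pd a (fun w => (f w, g w)) u = (pd a f u, pd a g u) := by
  unfold pd
  rw [(differentiableAt_of_contDiffOn hO hf hu).fderiv_prodMk
    (differentiableAt_of_contDiffOn hO hg hu)]
  rfl

theorem pd_add {f g : Euc n → F} (hO : IsOpen O) (hf : ContDiffOn ℝ ∞ f O)
    (hg : ContDiffOn ℝ ∞ g O) (hu : u ∈ O) (a : Fin n) :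
    pd a (fun w => f w + g w) u = pd a f u + pd a g u := by
  unfold pd
  rw [fderiv_fun_add (differentiableAt_of_contDiffOn hO hf hu)
    (differentiableAt_of_contDiffOn hO hg hu)]
  rfl

theorem pd_neg (f : Euc n → F) (u : Euc n) (a : Fin n) :
    pd a (fun w => -f w) u = -pd a f u := by
  unfold pd
  rw [fderiv_fun_neg]
  rfl

end ProductDerivatives

/-- The isotropic lift `((1 + |x|²)/2, (1 - |x|²)/2, x, 0)` of a point of Euclidean space. -/
def pointLift {n : ℕ} (x : Euc n → Euc (n + 1)) (u : Euc n) : LSpace n :=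
  ((1 + ‖x u‖ ^ 2) / 2, (1 - ‖x u‖ ^ 2) / 2, x u, 0)

/-- The vector `P = (1, -1, 0, 0)`. -/
def isotropicVector (n : ℕ) : LSpace n := (1, -1, 0, 0)

theorem form_isotropicVector {n : ℕ} (X : LSpace n) :
    form X (isotropicVector n) = -(X.1 + X.2.1) := by
  simp [form, isotropicVector]
  ring

/-! ### Smoothness of the invariants and the products of $Y$, $\eta$, $P$ and their derivatives -/

namespace IsLocalHypersurface

open Matrix

variable {n : ℕ} {x ξ : Euc n → Euc (n + 1)} {O : Set (Euc n)} (H : IsLocalHypersurface x ξ O)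
  {u : Euc n}
include H

/-! ### Smoothness -/

theorem smoothEntries_thirdForm : SmoothEntries (thirdForm ξ) O := fun a b =>
  (contDiffOn_pd H.isOpen H.smooth_normal a).inner ℝ (contDiffOn_pd H.isOpen H.smooth_normal b)

theorem smoothEntries_secondForm : SmoothEntries (secondForm x ξ) O := fun a b =>
  ((contDiffOn_pd H.isOpen H.smooth a).inner ℝ (contDiffOn_pd H.isOpen H.smooth_normal b)).neg

theorem thirdForm_det_ne_zero (hu : u ∈ O) : (thirdForm ξ u).det ≠ 0 := by
  obtain ⟨Q, s, h, -⟩ := H.exists_radii_frame hu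
  intro h0
  have := congrArg det h
  rw [det_mul, det_mul, h0, mul_zero, zero_mul, det_one] at this
  exact zero_ne_one this

/-- Individual curvature radii need not be smooth functions, but their symmetric functions are
traces of smooth matrices. This formula and `rho_eq` serve to prove that $r$ and $\rho$ are smooth.
-/
theorem meanRadius_eq (hu : u ∈ O) :
    meanRadius x ξ u = ((thirdForm ξ u)⁻¹ * secondForm x ξ u).trace / n := by
  obtain ⟨Q, s, h, hs, hr, -⟩ := H.exists_radii_frame hu
  rw [meanRadius, hr, inv_mul_eq_conj h hs, trace_conj h, trace_diagonal]
  rfl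

theorem rho_eq (hu : u ∈ O) :
    rho x ξ u = √((meanRadius x ξ u • 1 - (thirdForm ξ u)⁻¹ * secondForm x ξ u) *
      (meanRadius x ξ u • 1 - (thirdForm ξ u)⁻¹ * secondForm x ξ u)).trace := by
  obtain ⟨Q, s, h, hs, hr, -⟩ := H.exists_radii_frame hu
  have h1 : meanRadius x ξ u • 1 - (thirdForm ξ u)⁻¹ * secondForm x ξ u =
      Q * diagonal (fun i => meanRadius x ξ u - s i) * (Qᵀ * thirdForm ξ u) := by
    have h2 : diagonal (fun i => meanRadius x ξ u - s i) =
        meanRadius x ξ u • 1 - diagonal s := by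
      rw [← diagonal_one, ← diagonal_smul, diagonal_sub]
      simp
    rw [h2, inv_mul_eq_conj h hs, Matrix.mul_sub, Matrix.sub_mul, Matrix.mul_smul,
      Matrix.mul_one, Matrix.smul_mul, mul_transpose_mul_eq_one h]
  have h3 : ∀ D : Matrix (Fin n) (Fin n) ℝ, Q * D * (Qᵀ * thirdForm ξ u) *
      (Q * D * (Qᵀ * thirdForm ξ u)) = Q * (D * D) * (Qᵀ * thirdForm ξ u) := by
    intro D
    calc _ = Q * D * (Qᵀ * thirdForm ξ u * Q) * D * (Qᵀ * thirdForm ξ u) := by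
          simp only [Matrix.mul_assoc]
      _ = _ := by rw [h, Matrix.mul_one]; simp only [Matrix.mul_assoc]
  rw [h1, h3, trace_conj h, diagonal_mul_diagonal, trace_diagonal, rho, hr, Multiset.map_map]
  simp only [← sq]
  rfl

theorem rho_pos (hu : u ∈ O) : 0 < rho x ξ u := by
  obtain ⟨Q, s, h, hs, hr, i, k, hik⟩ := H.exists_radii_frame hu
  rw [rho, hr, Multiset.map_map, Real.sqrt_pos]
  have : ∃ j, meanRadius x ξ u ≠ s j := by
    by_contra hcon
    push Not at hcon
    exact hik ((hcon i).symm.trans (hcon k))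
  obtain ⟨j, hj⟩ := this
  exact Finset.sum_pos' (f := fun i => (meanRadius x ξ u - s i) ^ 2) (fun _ _ => sq_nonneg _)
    ⟨j, Finset.mem_univ j, by have := sub_ne_zero.2 hj; positivity⟩

theorem smoothEntries_radii :
    SmoothEntries (fun u => (thirdForm ξ u)⁻¹ * secondForm x ξ u) O :=
  (H.smoothEntries_thirdForm.inv fun _ hu => H.thirdForm_det_ne_zero hu).mul
    H.smoothEntries_secondForm

theorem contDiffOn_meanRadius : ContDiffOn ℝ ∞ (meanRadius x ξ) O :=
  (H.smoothEntries_radii.trace.div_const _).congr fun _ hu => H.meanRadius_eq hu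

theorem contDiffOn_rho : ContDiffOn ℝ ∞ (rho x ξ) O := by
  have h1 : SmoothEntries (fun u => meanRadius x ξ u • (1 : Matrix (Fin n) (Fin n) ℝ) -
      (thirdForm ξ u)⁻¹ * secondForm x ξ u) O :=
    (SmoothEntries.smul H.contDiffOn_meanRadius (smoothEntries_const _)).sub H.smoothEntries_radii
  refine ((h1.mul h1).trace.sqrt fun u hu h0 => ?_).congr fun _ hu => H.rho_eq hu
  have := H.rho_pos hu
  rw [H.rho_eq hu, h0, Real.sqrt_zero] at this
  exact lt_irrefl _ this

theorem contDiffOn_inner : ContDiffOn ℝ ∞ (fun u => inner ℝ (x u) (ξ u)) O :=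
  H.smooth.inner ℝ H.smooth_normal

theorem contDiffOn_unscaledPosition : ContDiffOn ℝ ∞ (unscaledPosition x ξ) O :=
  H.contDiffOn_inner.prodMk (H.contDiffOn_inner.neg.prodMk
    (H.smooth_normal.prodMk contDiffOn_const))

theorem contDiffOn_position : ContDiffOn ℝ ∞ (position x ξ) O :=
  H.contDiffOn_rho.smul H.contDiffOn_unscaledPosition

theorem contDiffOn_pointLift : ContDiffOn ℝ ∞ (pointLift x) O :=
  ((contDiffOn_const.add (H.smooth.norm_sq ℝ)).div_const 2).prodMk
    (((contDiffOn_const.sub (H.smooth.norm_sq ℝ)).div_const 2).prodMk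
      (H.smooth.prodMk contDiffOn_const))

theorem contDiffOn_eta : ContDiffOn ℝ ∞ (eta x ξ) O :=
  H.contDiffOn_pointLift.add (H.contDiffOn_meanRadius.smul H.contDiffOn_unscaledPosition)

theorem smoothEntries_metric : SmoothEntries (metric x ξ) O :=
  SmoothEntries.smul (H.contDiffOn_rho.pow 2) H.smoothEntries_thirdForm

theorem metric_det_ne_zero (hu : u ∈ O) : (metric x ξ u).det ≠ 0 := by
  have := (H.rho_pos hu).ne'
  have := H.thirdForm_det_ne_zero hu
  rw [metric, det_smul]
  positivity

theorem smoothEntries_metric_inv : SmoothEntries (fun u => (metric x ξ u)⁻¹) O :=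
  H.smoothEntries_metric.inv fun _ hu => H.metric_det_ne_zero hu

theorem contDiffOn_christoffel (c a b : Fin n) :
    ContDiffOn ℝ ∞ (christoffel (metric x ξ) c a b) O :=
  contDiffOn_const.mul (ContDiffOn.sum fun d _ => (H.smoothEntries_metric_inv c d).mul
    (((contDiffOn_pd H.isOpen (H.smoothEntries_metric b d) a).add
      (contDiffOn_pd H.isOpen (H.smoothEntries_metric a d) b)).sub
      (contDiffOn_pd H.isOpen (H.smoothEntries_metric a b) d)))

theorem contDiffOn_hess (a b : Fin n) :
    ContDiffOn ℝ ∞ (hess (metric x ξ) (position x ξ) a b) O :=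
  (contDiffOn_pd H.isOpen (contDiffOn_pd H.isOpen H.contDiffOn_position b) a).sub
    (ContDiffOn.sum fun c _ => (H.contDiffOn_christoffel c a b).smul
      (contDiffOn_pd H.isOpen H.contDiffOn_position c))

theorem contDiffOn_laplacian :
    ContDiffOn ℝ ∞ (laplacian (metric x ξ) (position x ξ)) O :=
  ContDiffOn.sum fun a _ => ContDiffOn.sum fun b _ =>
    (H.smoothEntries_metric_inv a b).smul (H.contDiffOn_hess a b)

theorem contDiffOn_nVector : ContDiffOn ℝ ∞ (nVector x ξ) O :=
  (H.contDiffOn_laplacian.const_smul _).add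
    ((contDiffOn_const.mul (contDiffOn_form H.contDiffOn_laplacian H.contDiffOn_laplacian)).smul
      H.contDiffOn_position)

/-! ### Products in the moving frame -/

variable (hu : u ∈ O)
include hu

theorem pd_unscaledPosition (a : Fin n) :
    pd a (unscaledPosition x ξ) u =
      (inner ℝ (x u) (pd a ξ u), -inner ℝ (x u) (pd a ξ u), pd a ξ u, 0) := by
  have hO := H.isOpen
  have h1 := H.contDiffOn_inner
  have h2 : ContDiffOn ℝ ∞ (fun u => -inner ℝ (x u) (ξ u)) O := h1.neg
  have h3 : ContDiffOn ℝ ∞ (fun u => (ξ u, (1 : ℝ))) O := H.smooth_normal.prodMk contDiffOn_const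
  unfold unscaledPosition
  rw [pd_prodMk hO h1 (h2.prodMk h3) hu, pd_prodMk hO h2 h3 hu,
    pd_prodMk hO H.smooth_normal contDiffOn_const hu, pd_neg, pd_const,
    pd_inner hO H.smooth H.smooth_normal hu, H.normal u hu, zero_add]

theorem pd_pointLift (a : Fin n) :
    pd a (pointLift x) u =
      (inner ℝ (x u) (pd a x u), -inner ℝ (x u) (pd a x u), pd a x u, 0) := by
  have hO := H.isOpen
  have h1 : ContDiffOn ℝ ∞ (fun u => (1 + ‖x u‖ ^ 2) / 2) O :=
    (contDiffOn_const.add (H.smooth.norm_sq ℝ)).div_const 2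
  have h2 : ContDiffOn ℝ ∞ (fun u => (1 - ‖x u‖ ^ 2) / 2) O :=
    (contDiffOn_const.sub (H.smooth.norm_sq ℝ)).div_const 2
  have h3 : ContDiffOn ℝ ∞ (fun u => (x u, (0 : ℝ))) O := H.smooth.prodMk contDiffOn_const
  have h4 : HasFDerivAt (fun w => ‖x w‖ ^ 2) (2 • (innerSL ℝ (x u)).comp (fderiv ℝ x u)) u :=
    (differentiableAt_of_contDiffOn hO H.smooth hu).hasFDerivAt.norm_sq
  have h5 : pd a (fun u => (1 + ‖x u‖ ^ 2) / 2) u = inner ℝ (x u) (pd a x u) := by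
    have h6 := ((h4.const_add 1).mul_const (2 : ℝ)⁻¹).fderiv
    unfold pd
    simp only [div_eq_mul_inv]
    rw [h6]
    simp
  have h7 : pd a (fun u => (1 - ‖x u‖ ^ 2) / 2) u = -inner ℝ (x u) (pd a x u) := by
    have h6 := ((h4.const_sub 1).mul_const (2 : ℝ)⁻¹).fderiv
    unfold pd
    simp only [div_eq_mul_inv]
    rw [h6]
    simp
  unfold pointLift
  rw [pd_prodMk hO h1 (h2.prodMk h3) hu, pd_prodMk hO h2 h3 hu,
    pd_prodMk hO H.smooth contDiffOn_const hu, pd_const, h5, h7]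

theorem pd_position (a : Fin n) :
    pd a (position x ξ) u = pd a (rho x ξ) u • unscaledPosition x ξ u +
      rho x ξ u • pd a (unscaledPosition x ξ) u :=
  pd_smul H.isOpen H.contDiffOn_rho H.contDiffOn_unscaledPosition hu a

theorem pd_eta (a : Fin n) :
    pd a (eta x ξ) u = pd a (pointLift x) u + (pd a (meanRadius x ξ) u • unscaledPosition x ξ u +
      meanRadius x ξ u • pd a (unscaledPosition x ξ) u) := by
  rw [← pd_smul H.isOpen H.contDiffOn_meanRadius H.contDiffOn_unscaledPosition hu,
    ← pd_add (g := fun w => meanRadius x ξ w • unscaledPosition x ξ w) H.isOpen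
      H.contDiffOn_pointLift (H.contDiffOn_meanRadius.smul H.contDiffOn_unscaledPosition) hu]
  rfl

theorem form_unscaled_unscaled : form (unscaledPosition x ξ u) (unscaledPosition x ξ u) = 0 := by
  simp only [form, unscaledPosition, H.unit u hu]
  ring

theorem form_pd_unscaled_unscaled (a : Fin n) :
    form (pd a (unscaledPosition x ξ) u) (unscaledPosition x ξ u) = 0 := by
  rw [H.pd_unscaledPosition hu]
  simp only [form, unscaledPosition, H.inner_pd_normal hu]
  ring

theorem form_pd_unscaled_pd_unscaled (a b : Fin n) :
    form (pd a (unscaledPosition x ξ) u) (pd b (unscaledPosition x ξ) u) = thirdForm ξ u a b := by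
  rw [H.pd_unscaledPosition hu, H.pd_unscaledPosition hu]
  simp only [form, thirdForm, of_apply]
  ring

omit H hu in
theorem form_unscaled_pointLift : form (unscaledPosition x ξ u) (pointLift x u) = 0 := by
  simp only [form, unscaledPosition, pointLift, real_inner_comm (ξ u) (x u)]
  ring

theorem form_pd_unscaled_pointLift (a : Fin n) :
    form (pd a (unscaledPosition x ξ) u) (pointLift x u) = 0 := by
  rw [H.pd_unscaledPosition hu]
  simp only [form, pointLift, real_inner_comm (pd a ξ u) (x u)]
  ring

theorem form_unscaled_pd_pointLift (a : Fin n) :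
    form (unscaledPosition x ξ u) (pd a (pointLift x) u) = 0 := by
  rw [H.pd_pointLift hu]
  simp only [form, unscaledPosition, real_inner_comm (pd a x u) (ξ u), H.normal u hu]
  ring

theorem form_pd_unscaled_pd_pointLift (a b : Fin n) :
    form (pd a (unscaledPosition x ξ) u) (pd b (pointLift x) u) = -secondForm x ξ u b a := by
  rw [H.pd_pointLift hu, H.pd_unscaledPosition hu]
  simp only [form, secondForm, of_apply, real_inner_comm (pd b x u) (pd a ξ u)]
  ring

omit H hu in
theorem form_pointLift_pointLift : form (pointLift x u) (pointLift x u) = 0 := by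
  simp only [form, pointLift, real_inner_self_eq_norm_sq]
  ring

theorem form_position_position : form (position x ξ u) (position x ξ u) = 0 := by
  rw [position, form_smul_left, form_smul_right, H.form_unscaled_unscaled hu, mul_zero, mul_zero]

theorem form_pd_position_position (a : Fin n) :
    form (pd a (position x ξ) u) (position x ξ u) = 0 := by
  rw [H.pd_position hu, position]
  simp only [form_add_left, form_smul_left, form_smul_right, H.form_unscaled_unscaled hu,
    H.form_pd_unscaled_unscaled hu, mul_zero, add_zero]

theorem form_pd_position_pd_position (a b : Fin n) :
    form (pd a (position x ξ) u) (pd b (position x ξ) u) = metric x ξ u a b := by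
  rw [H.pd_position hu, H.pd_position hu]
  simp only [form_add_left, form_add_right, form_smul_left, form_smul_right,
    H.form_unscaled_unscaled hu, H.form_pd_unscaled_unscaled hu, H.form_pd_unscaled_pd_unscaled hu,
    form_comm (unscaledPosition x ξ u) (pd _ _ _), metric, Matrix.smul_apply, smul_eq_mul]
  ring

theorem form_position_eta : form (position x ξ u) (eta x ξ u) = 0 := by
  change form (rho x ξ u • unscaledPosition x ξ u)
    (pointLift x u + meanRadius x ξ u • unscaledPosition x ξ u) = 0
  simp only [form_add_right, form_smul_left, form_smul_right,
    H.form_unscaled_unscaled hu, form_unscaled_pointLift]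
  ring

theorem form_pd_position_eta (a : Fin n) : form (pd a (position x ξ) u) (eta x ξ u) = 0 := by
  rw [H.pd_position hu]
  change form _ (pointLift x u + meanRadius x ξ u • unscaledPosition x ξ u) = 0
  simp only [form_add_right, form_add_left, form_smul_left, form_smul_right,
    H.form_unscaled_unscaled hu, form_unscaled_pointLift, H.form_pd_unscaled_unscaled hu,
    H.form_pd_unscaled_pointLift hu]
  ring

theorem form_eta_eta : form (eta x ξ u) (eta x ξ u) = 0 := by
  change form (pointLift x u + meanRadius x ξ u • unscaledPosition x ξ u)
    (pointLift x u + meanRadius x ξ u • unscaledPosition x ξ u) = 0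
  simp only [form_add_right, form_add_left, form_smul_left, form_smul_right,
    H.form_unscaled_unscaled hu, form_unscaled_pointLift, form_pointLift_pointLift,
    form_comm (pointLift x u) (unscaledPosition x ξ u)]
  ring

theorem form_pd_position_pd_eta (a b : Fin n) :
    form (pd a (position x ξ) u) (pd b (eta x ξ) u) =
      rho x ξ u * (meanRadius x ξ u * thirdForm ξ u a b - secondForm x ξ u b a) := by
  rw [H.pd_position hu, H.pd_eta hu]
  simp only [form_add_right, form_add_left, form_smul_left, form_smul_right,
    H.form_unscaled_unscaled hu, H.form_pd_unscaled_unscaled hu,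
    H.form_pd_unscaled_pd_unscaled hu, H.form_unscaled_pd_pointLift hu,
    H.form_pd_unscaled_pd_pointLift hu, form_comm (unscaledPosition x ξ u) (pd _ _ _)]
  ring

omit H hu in
theorem form_position_isotropicVector (u : Euc n) :
    form (position x ξ u) (isotropicVector n) = 0 := by
  rw [form_isotropicVector, position, unscaledPosition]
  simp

omit H hu in
theorem form_eta_isotropicVector (u : Euc n) : form (eta x ξ u) (isotropicVector n) = -1 := by
  rw [form_isotropicVector, eta, unscaledPosition]
  simp
  ring

omit H hu in
theorem form_isotropicVector_self : form (isotropicVector n) (isotropicVector n) = 0 := by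
  rw [form_isotropicVector, isotropicVector]
  simp

theorem form_pd_position_isotropicVector (a : Fin n) :
    form (pd a (position x ξ) u) (isotropicVector n) = 0 := by
  have h := pd_congr H.isOpen (fun w _ => form_position_isotropicVector (x := x) (ξ := ξ) w) hu a
  rw [pd_form H.isOpen H.contDiffOn_position contDiffOn_const hu, pd_const, pd_const,
    form_zero_right, add_zero] at h
  exact h

theorem form_pd_eta_isotropicVector (a : Fin n) :
    form (pd a (eta x ξ) u) (isotropicVector n) = 0 := by
  have h := pd_congr H.isOpen (fun w _ => form_eta_isotropicVector (x := x) (ξ := ξ) w) hu a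
  rw [pd_form H.isOpen H.contDiffOn_eta contDiffOn_const hu, pd_const, pd_const,
    form_zero_right, add_zero] at h
  exact h

theorem form_pd_eta_eta (a : Fin n) : form (pd a (eta x ξ) u) (eta x ξ u) = 0 := by
  have h := pd_congr H.isOpen (fun w hw => H.form_eta_eta hw) hu a
  rw [pd_form H.isOpen H.contDiffOn_eta H.contDiffOn_eta hu, pd_const,
    form_comm (eta x ξ u)] at h
  linarith

theorem form_pd_eta_position (a : Fin n) : form (pd a (eta x ξ) u) (position x ξ u) = 0 := by
  have h := pd_congr H.isOpen (fun w hw => H.form_position_eta hw) hu a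
  rw [pd_form H.isOpen H.contDiffOn_position H.contDiffOn_eta hu, pd_const,
    H.form_pd_position_eta hu, zero_add, form_comm] at h
  exact h

theorem metric_symm (a b : Fin n) : metric x ξ u a b = metric x ξ u b a := by
  rw [← H.form_pd_position_pd_position hu, form_comm, H.form_pd_position_pd_position hu]

/-! ### The Hessian of the Laguerre position vector -/

theorem form_pd_pd_position_isotropicVector (a b : Fin n) :
    form (pd a (pd b (position x ξ)) u) (isotropicVector n) = 0 := by
  have h := pd_congr H.isOpen (fun w hw => H.form_pd_position_isotropicVector hw b) hu a
  rw [pd_form H.isOpen (contDiffOn_pd H.isOpen H.contDiffOn_position b) contDiffOn_const hu,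
    pd_const, pd_const, form_zero_right, add_zero] at h
  exact h

theorem form_pd_pd_position_position (a b : Fin n) :
    form (pd a (pd b (position x ξ)) u) (position x ξ u) = -metric x ξ u a b := by
  have h := pd_congr H.isOpen (fun w hw => H.form_pd_position_position hw b) hu a
  rw [pd_form H.isOpen (contDiffOn_pd H.isOpen H.contDiffOn_position b) H.contDiffOn_position hu,
    pd_const, H.form_pd_position_pd_position hu, H.metric_symm hu] at h
  linarith

theorem form_pd_pd_position_eta (a b : Fin n) :
    form (pd a (pd b (position x ξ)) u) (eta x ξ u) =
      -form (pd b (position x ξ) u) (pd a (eta x ξ) u) := by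
  have h := pd_congr H.isOpen (fun w hw => H.form_pd_position_eta hw b) hu a
  rw [pd_form H.isOpen (contDiffOn_pd H.isOpen H.contDiffOn_position b) H.contDiffOn_eta hu,
    pd_const] at h
  linarith

theorem pd_metric (a b c : Fin n) :
    pd a (fun w => metric x ξ w b c) u =
      form (pd a (pd b (position x ξ)) u) (pd c (position x ξ) u) +
        form (pd b (position x ξ) u) (pd a (pd c (position x ξ)) u) := by
  rw [← pd_form H.isOpen (contDiffOn_pd H.isOpen H.contDiffOn_position b)
    (contDiffOn_pd H.isOpen H.contDiffOn_position c) hu]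
  exact pd_congr H.isOpen (fun w hw => (H.form_pd_position_pd_position hw b c).symm) hu a

/-- Because $g_{ab}=\langle\partial_aY,\partial_bY\rangle$, the usual computation for an isometric
immersion applies: the lowered Christoffel symbols are the tangential products of the flat second
derivatives. Hence the Hessian of $Y$ is orthogonal to $dY$. -/
theorem sum_christoffel (a b c : Fin n) :
    ∑ d, christoffel (metric x ξ) d a b u * metric x ξ u d c =
      form (pd a (pd b (position x ξ)) u) (pd c (position x ξ) u) := by
  set f : Fin n → ℝ := fun e => pd a (fun w => metric x ξ w b e) u +
    pd b (fun w => metric x ξ w a e) u - pd e (fun w => metric x ξ w a b) u with hf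
  have h1 : ∀ d, christoffel (metric x ξ) d a b u = (1 / 2) * ((metric x ξ u)⁻¹ *ᵥ f) d :=
    fun d => rfl
  have h2 : metric x ξ u *ᵥ ((metric x ξ u)⁻¹ *ᵥ f) = f := by
    rw [mulVec_mulVec, mul_nonsing_inv _ (isUnit_iff_ne_zero.2 (H.metric_det_ne_zero hu)),
      one_mulVec]
  have h3 : ∑ d, christoffel (metric x ξ) d a b u * metric x ξ u d c = (1 / 2) * f c := by
    conv_rhs => rw [← h2]
    rw [mulVec, dotProduct, Finset.mul_sum]
    refine Finset.sum_congr rfl fun d _ => ?_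
    rw [h1, H.metric_symm hu d c]
    ring
  have hs := fun a b => pd_comm H.isOpen H.contDiffOn_position hu a b
  rw [h3, hf]
  beta_reduce
  rw [H.pd_metric hu, H.pd_metric hu, H.pd_metric hu, hs b a, hs c a, hs c b,
    form_comm (pd a (position x ξ) u), form_comm (pd b (position x ξ) u)]
  ring

omit H hu in
theorem form_hess (Z : LSpace n) (a b : Fin n) :
    form (hess (metric x ξ) (position x ξ) a b u) Z =
      form (pd a (pd b (position x ξ)) u) Z -
        ∑ c, christoffel (metric x ξ) c a b u * form (pd c (position x ξ) u) Z := by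
  rw [hess, form_sub_left, form_sum_left]
  simp only [form_smul_left]

omit H hu in
theorem form_hess_of_orthogonal {Z : LSpace n} (hZ : ∀ c, form (pd c (position x ξ) u) Z = 0)
    (a b : Fin n) : form (hess (metric x ξ) (position x ξ) a b u) Z =
      form (pd a (pd b (position x ξ)) u) Z := by
  simp [form_hess, hZ]

theorem form_hess_pd_position (a b c : Fin n) :
    form (hess (metric x ξ) (position x ξ) a b u) (pd c (position x ξ) u) = 0 := by
  rw [form_hess]
  simp only [H.form_pd_position_pd_position hu]
  rw [H.sum_christoffel hu, sub_self]

theorem laguerreSecondForm_apply (a b : Fin n) :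
    laguerreSecondForm x ξ u a b = form (pd b (position x ξ) u) (pd a (eta x ξ) u) := by
  rw [laguerreSecondForm, of_apply, form_hess_of_orthogonal (H.form_pd_position_eta hu),
    H.form_pd_pd_position_eta hu, neg_neg]

/-- Relative to $g=\rho^2\,d\xi\cdot d\xi$ this gives the eigenvalues $b_i=\rho^{-1}(r-r_i)$, which
sum to zero and are not all equal. -/
theorem laguerreSecondForm_eq : laguerreSecondForm x ξ u =
    rho x ξ u • (meanRadius x ξ u • thirdForm ξ u - secondForm x ξ u) := by
  ext a b
  rw [H.laguerreSecondForm_apply hu, H.form_pd_position_pd_eta hu]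
  have : thirdForm ξ u b a = thirdForm ξ u a b :=
    real_inner_comm (pd a ξ u) (pd b ξ u)
  rw [this]
  rfl


/-- A frame diagonalizing the Laguerre second fundamental form. -/
theorem exists_laguerre_frame :
    ∃ (Q : Matrix (Fin n) (Fin n) ℝ) (d : Fin n → ℝ), Qᵀ * metric x ξ u * Q = 1 ∧
      Qᵀ * laguerreSecondForm x ξ u * Q = diagonal d ∧ ∑ i, d i = 0 ∧ ∃ i k, d i ≠ d k := by
  obtain ⟨Q, s, h, hs, hr, i, k, hik⟩ := H.exists_radii_frame hu
  have hρ := (H.rho_pos hu).ne'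
  refine ⟨(rho x ξ u)⁻¹ • Q, fun j => (rho x ξ u)⁻¹ * (meanRadius x ξ u - s j), ?_, ?_, ?_, i, k, ?_⟩
  · rw [metric, transpose_smul, Matrix.smul_mul, Matrix.mul_smul, Matrix.smul_mul,
      Matrix.mul_smul, Matrix.smul_mul, h, smul_smul, smul_smul]
    rw [show (rho x ξ u)⁻¹ * (rho x ξ u)⁻¹ * rho x ξ u ^ 2 = 1 by field_simp, one_smul]
  · rw [H.laguerreSecondForm_eq hu, transpose_smul, Matrix.smul_mul, Matrix.mul_smul,
      Matrix.smul_mul, Matrix.mul_smul, Matrix.smul_mul, smul_smul, smul_smul, Matrix.mul_sub,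
      Matrix.sub_mul, Matrix.mul_smul, Matrix.smul_mul, h, hs,
      show (rho x ξ u)⁻¹ * (rho x ξ u)⁻¹ * rho x ξ u = (rho x ξ u)⁻¹ by field_simp,
      ← diagonal_one, ← diagonal_smul, diagonal_sub, ← diagonal_smul]
    congr 1
    ext j
    simp
  · have hn : (n : ℝ) ≠ 0 := Nat.cast_ne_zero.2 (Fin.pos i).ne'
    have hm : meanRadius x ξ u = (∑ j, s j) / n := by rw [meanRadius, hr]; rfl
    rw [← Finset.mul_sum, Finset.sum_sub_distrib, hm]
    simp
    right
    field_simp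
    ring
  · intro h'
    have := mul_left_cancel₀ (inv_ne_zero hρ) h'
    exact hik (by linarith)

end IsLocalHypersurface

/-- The expansion of a vector in a moving frame of Laguerre geometry. -/
theorem eq_frame_expansion {n : ℕ} {X : Fin n → LSpace n} {Y N η P : LSpace n}
    (hXX : ∀ i j, form (X i) (X j) = if i = j then 1 else 0) (hXY : ∀ i, form (X i) Y = 0)
    (hXN : ∀ i, form (X i) N = 0) (hXη : ∀ i, form (X i) η = 0) (hXP : ∀ i, form (X i) P = 0)
    (hYY : form Y Y = 0) (hNN : form N N = 0) (hηη : form η η = 0) (hPP : form P P = 0)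
    (hYN : form Y N = -1) (hYη : form Y η = 0) (hYP : form Y P = 0) (hNη : form N η = 0)
    (hNP : form N P = 0) (hηP : form η P = -1) (Z : LSpace n) :
    Z = ∑ j, form Z (X j) • X j - form Z N • Y - form Z Y • N - form Z P • η - form Z η • P := by
  -- The products with the frame recover all coefficients, so the linear combination map is
  -- injective; both spaces have dimension $n+4$, so it is onto.
  let Ψ : ((Fin n → ℝ) × ℝ × ℝ × ℝ × ℝ) →ₗ[ℝ] LSpace n :=
    { toFun := fun c => ∑ j, c.1 j • X j + c.2.1 • Y + c.2.2.1 • N + c.2.2.2.1 • η +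
        c.2.2.2.2 • P
      map_add' := fun c c' => by
        simp only [Prod.fst_add, Prod.snd_add, Pi.add_apply, add_smul, Finset.sum_add_distrib]
        abel
      map_smul' := fun r c => by
        simp only [Prod.smul_fst, Prod.smul_snd, Pi.smul_apply, smul_add, smul_smul,
          Finset.smul_sum, smul_eq_mul, RingHom.id_apply] }
  have hΨ : ∀ c, Ψ c = ∑ j, c.1 j • X j + c.2.1 • Y + c.2.2.1 • N + c.2.2.2.1 • η +
    c.2.2.2.2 • P := fun c => rfl
  have eX : ∀ c j, form (Ψ c) (X j) = c.1 j := by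
    intro c j
    rw [hΨ]
    simp only [form_add_left, form_smul_left, form_sum_left, hXX, form_comm Y (X j),
      form_comm N (X j), form_comm η (X j), form_comm P (X j), hXY, hXN, hXη, hXP]
    simp
  have eY : ∀ c, form (Ψ c) Y = -c.2.2.1 := by
    intro c
    rw [hΨ]
    simp only [form_add_left, form_smul_left, form_sum_left, form_comm N Y, form_comm η Y,
      form_comm P Y, hXY, hYY, hYN, hYη, hYP]
    simp
  have eN : ∀ c, form (Ψ c) N = -c.2.1 := by
    intro c
    rw [hΨ]
    simp only [form_add_left, form_smul_left, form_sum_left, form_comm η N,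
      form_comm P N, hXN, hNN, hYN, hNη, hNP]
    simp
  have eη : ∀ c, form (Ψ c) η = -c.2.2.2.2 := by
    intro c
    rw [hΨ]
    simp only [form_add_left, form_smul_left, form_sum_left, form_comm P η, hXη, hYη, hNη, hηη, hηP]
    simp
  have eP : ∀ c, form (Ψ c) P = -c.2.2.2.1 := by
    intro c
    rw [hΨ]
    simp only [form_add_left, form_smul_left, form_sum_left, hXP, hYP, hNP, hPP, hηP]
    simp
  have hinj : Function.Injective Ψ := by
    rw [← LinearMap.ker_eq_bot, LinearMap.ker_eq_bot']
    intro c hc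
    have h1 := eX c
    have h2 := eY c
    have h3 := eN c
    have h4 := eη c
    have h5 := eP c
    rw [hc] at h2 h3 h4 h5
    simp only [hc, form_zero_left] at h1 h2 h3 h4 h5
    refine Prod.ext (funext fun j => (h1 j).symm) (Prod.ext ?_ (Prod.ext ?_ (Prod.ext ?_ ?_)))
    all_goals simp only [Prod.fst_zero, Prod.snd_zero]; linarith
  have hfin : Module.finrank ℝ ((Fin n → ℝ) × ℝ × ℝ × ℝ × ℝ) = Module.finrank ℝ (LSpace n) := by
    simp only [Module.finrank_prod, Module.finrank_fin_fun, Module.finrank_self,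
      finrank_euclideanSpace_fin]
    ring
  obtain ⟨c, rfl⟩ := (LinearMap.injective_iff_surjective_of_finrank_eq_finrank hfin).1 hinj Z
  simp only [eX, eY, eN, eη, eP]
  rw [hΨ]
  module

/-! ### The moving frame and its structure equations -/

namespace IsLocalHypersurface

open Matrix

variable {n : ℕ} {x ξ : Euc n → Euc (n + 1)} {O : Set (Euc n)} (H : IsLocalHypersurface x ξ O)
  {u : Euc n} (hu : u ∈ O)
include H hu

omit H hu in
theorem form_laplacian (Z : LSpace n) :
    form (laplacian (metric x ξ) (position x ξ) u) Z =
      ∑ a, ∑ b, (metric x ξ u)⁻¹ a b * form (hess (metric x ξ) (position x ξ) a b u) Z := by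
  simp only [laplacian, form_sum_left, form_smul_left]

theorem metric_transpose : (metric x ξ u)ᵀ = metric x ξ u := by
  ext a b
  rw [transpose_apply, H.metric_symm hu]

theorem laguerreSecondForm_transpose :
    (laguerreSecondForm x ξ u)ᵀ = laguerreSecondForm x ξ u := by
  have h : (thirdForm ξ u)ᵀ = thirdForm ξ u := by
    ext a b
    exact real_inner_comm (pd a ξ u) (pd b ξ u)
  rw [H.laguerreSecondForm_eq hu, transpose_smul, transpose_sub, transpose_smul, h,
    H.secondForm_transpose hu]

omit H hu in
theorem sum_mul_eq_trace (g T : Matrix (Fin n) (Fin n) ℝ) (hT : Tᵀ = T) :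
    ∑ a, ∑ b, g a b * T a b = (g * T).trace := by
  refine Finset.sum_congr rfl fun a _ => ?_
  rw [diag_apply, Matrix.mul_apply]
  refine Finset.sum_congr rfl fun b _ => ?_
  conv_lhs => rw [← hT]
  rfl

theorem form_laplacian_position :
    form (laplacian (metric x ξ) (position x ξ) u) (position x ξ u) = -n := by
  rw [form_laplacian]
  simp only [form_hess_of_orthogonal (H.form_pd_position_position hu),
    H.form_pd_pd_position_position hu, mul_neg, Finset.sum_neg_distrib]
  rw [sum_mul_eq_trace _ _ (H.metric_transpose hu),
    nonsing_inv_mul _ (isUnit_iff_ne_zero.2 (H.metric_det_ne_zero hu))]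
  simp

/-- The product is minus the trace of $\mathbb B$, which vanishes because $r$ is the mean of the
$r_i$. -/
theorem form_laplacian_eta :
    form (laplacian (metric x ξ) (position x ξ) u) (eta x ξ u) = 0 := by
  have h : ∀ a b, form (hess (metric x ξ) (position x ξ) a b u) (eta x ξ u) =
      -laguerreSecondForm x ξ u a b := fun a b => by
    rw [laguerreSecondForm, of_apply, neg_neg]
  obtain ⟨Q, d, hQ, hd, h0, -⟩ := H.exists_laguerre_frame hu
  rw [form_laplacian]
  simp only [h, mul_neg, Finset.sum_neg_distrib]
  rw [sum_mul_eq_trace _ _ (H.laguerreSecondForm_transpose hu), inv_mul_eq_conj hQ hd,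
    trace_conj hQ, trace_diagonal, h0, neg_zero]

theorem form_laplacian_pd_position (c : Fin n) :
    form (laplacian (metric x ξ) (position x ξ) u) (pd c (position x ξ) u) = 0 := by
  simp [form_laplacian, H.form_hess_pd_position hu]

theorem form_laplacian_isotropicVector :
    form (laplacian (metric x ξ) (position x ξ) u) (isotropicVector n) = 0 := by
  simp [form_laplacian, form_hess_of_orthogonal (H.form_pd_position_isotropicVector hu),
    H.form_pd_pd_position_isotropicVector hu]

theorem natCast_ne_zero : (n : ℝ) ≠ 0 := by
  obtain ⟨Q, s, -, -, -, i, -⟩ := H.exists_radii_frame hu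
  exact Nat.cast_ne_zero.2 (Fin.pos i).ne'

theorem form_position_nVector : form (position x ξ u) (nVector x ξ u) = -1 := by
  have hn := H.natCast_ne_zero hu
  rw [form_comm, nVector, form_add_left, form_smul_left, form_smul_left,
    H.form_laplacian_position hu, H.form_position_position hu]
  field_simp
  ring

theorem form_nVector_eta : form (nVector x ξ u) (eta x ξ u) = 0 := by
  rw [nVector, form_add_left, form_smul_left, form_smul_left, H.form_laplacian_eta hu,
    H.form_position_eta hu, mul_zero, mul_zero, add_zero]

theorem form_nVector_isotropicVector : form (nVector x ξ u) (isotropicVector n) = 0 := by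
  rw [nVector, form_add_left, form_smul_left, form_smul_left,
    H.form_laplacian_isotropicVector hu, form_position_isotropicVector, mul_zero, mul_zero,
    add_zero]

theorem form_pd_position_nVector (c : Fin n) :
    form (pd c (position x ξ) u) (nVector x ξ u) = 0 := by
  rw [form_comm, nVector, form_add_left, form_smul_left, form_smul_left,
    H.form_laplacian_pd_position hu, form_comm (position x ξ u), H.form_pd_position_position hu,
    mul_zero, mul_zero, add_zero]

/-- The coefficient $\frac1{2n^2}\langle\Delta Y,\Delta Y\rangle$ of $Y$ in $N$ is exactly the one
that cancels $\frac1{n^2}\langle\Delta Y,\Delta Y\rangle$, since $\langle\Delta Y,Y\rangle=-n$. -/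
theorem form_nVector_nVector : form (nVector x ξ u) (nVector x ξ u) = 0 := by
  have hn := H.natCast_ne_zero hu
  rw [nVector]
  simp only [form_add_left, form_add_right, form_smul_left, form_smul_right,
    form_comm (position x ξ u) (laplacian _ _ _), H.form_laplacian_position hu,
    H.form_position_position hu]
  field_simp
  ring

theorem expansion {Q : Matrix (Fin n) (Fin n) ℝ} (hQ : Qᵀ * metric x ξ u * Q = 1)
    {X : Fin n → LSpace n} (hX : ∀ j, X j = ∑ a, Q a j • pd a (position x ξ) u) (Z : LSpace n) :
    Z = ∑ j, form Z (X j) • X j - form Z (nVector x ξ u) • position x ξ u -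
      form Z (position x ξ u) • nVector x ξ u - form Z (isotropicVector n) • eta x ξ u -
      form Z (eta x ξ u) • isotropicVector n := by
  have h0 : ∀ W, (∀ a, form (pd a (position x ξ) u) W = 0) → ∀ j, form (X j) W = 0 := by
    intro W hW j
    rw [hX, form_sum_left]
    simp [form_smul_left, hW]
  refine eq_frame_expansion (fun i j => ?_) (h0 _ (H.form_pd_position_position hu))
    (h0 _ (H.form_pd_position_nVector hu)) (h0 _ (H.form_pd_position_eta hu))
    (h0 _ (H.form_pd_position_isotropicVector hu)) (H.form_position_position hu)
    (H.form_nVector_nVector hu) (H.form_eta_eta hu) form_isotropicVector_self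
    (H.form_position_nVector hu) (H.form_position_eta hu) (form_position_isotropicVector u)
    (H.form_nVector_eta hu) (H.form_nVector_isotropicVector hu) (form_eta_isotropicVector u) Z
  rw [hX, hX, form_sum_left]
  simp only [form_sum_right, form_smul_left, form_smul_right, H.form_pd_position_pd_position hu]
  have := congrFun (congrFun hQ i) j
  rw [Matrix.one_apply, Matrix.mul_assoc, Matrix.mul_apply] at this
  rw [← this]
  refine Finset.sum_congr rfl fun a _ => ?_
  rw [Matrix.mul_apply, Finset.mul_sum, transpose_apply]
  exact Finset.sum_congr rfl fun b _ => by ring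

theorem form_pd_eta_nVector (a : Fin n) :
    form (pd a (eta x ξ) u) (nVector x ξ u) = laguerreForm x ξ u a := by
  have h := pd_congr H.isOpen (fun w hw => H.form_nVector_eta hw) hu a
  rw [pd_form H.isOpen H.contDiffOn_nVector H.contDiffOn_eta hu, pd_const,
    form_comm (nVector x ξ u)] at h
  rw [laguerreForm]
  linarith

/-- If the Laguerre form vanishes, `dη = dY ∘ A` with `A` the Laguerre shape operator. -/
theorem pd_eta_eq (hC : ∀ a, laguerreForm x ξ u a = 0) (a : Fin n) :
    pd a (eta x ξ) u =
      ∑ c, ((metric x ξ u)⁻¹ * laguerreSecondForm x ξ u) c a • pd c (position x ξ) u := by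
  obtain ⟨Q, d, hQ, -⟩ := H.exists_laguerre_frame hu
  set A := (metric x ξ u)⁻¹ * laguerreSecondForm x ξ u with hA
  -- All frame coefficients of this difference vanish. The Laguerre form enters only through the
  -- product with $N$.
  set Z := pd a (eta x ξ) u - ∑ c, A c a • pd c (position x ξ) u with hZ
  have h0 : ∀ W, form (pd a (eta x ξ) u) W = 0 → (∀ c, form (pd c (position x ξ) u) W = 0) →
      form Z W = 0 := by
    intro W h1 h2
    rw [hZ, form_sub_left, h1, form_sum_left]
    simp [form_smul_left, h2]
  have h1 : ∀ b, form Z (pd b (position x ξ) u) = 0 := by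
    intro b
    have h2 : metric x ξ u * A = laguerreSecondForm x ξ u := by
      rw [hA, ← Matrix.mul_assoc, mul_nonsing_inv _ (isUnit_iff_ne_zero.2 (H.metric_det_ne_zero hu)),
        Matrix.one_mul]
    have h3 := congrFun (congrFun h2 b) a
    have h4 : laguerreSecondForm x ξ u b a = form (pd a (eta x ξ) u) (pd b (position x ξ) u) := by
      rw [← H.laguerreSecondForm_transpose hu, transpose_apply, H.laguerreSecondForm_apply hu,
        form_comm]
    rw [hZ, form_sub_left, form_sum_left, ← h4, ← h3, Matrix.mul_apply, sub_eq_zero]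
    refine Finset.sum_congr rfl fun c _ => ?_
    rw [form_smul_left, H.form_pd_position_pd_position hu, H.metric_symm hu b c, mul_comm]
  have h2 := H.expansion hu hQ (fun j => rfl) Z
  rw [h0 _ (H.form_pd_eta_position hu a) (H.form_pd_position_position hu),
    h0 _ (H.form_pd_eta_eta hu a) (H.form_pd_position_eta hu),
    h0 _ (H.form_pd_eta_isotropicVector hu a) (H.form_pd_position_isotropicVector hu),
    h0 _ ((H.form_pd_eta_nVector hu a).trans (hC a)) (H.form_pd_position_nVector hu)] at h2
  simp only [form_sum_right, form_smul_right, h1] at h2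
  simp only [mul_zero, Finset.sum_const_zero, zero_smul, sub_zero] at h2
  exact sub_eq_zero.1 h2

/-- A Gauss-type identity: the products of second derivatives of the Laguerre position vector of
an `L`-isotropic hypersurface. -/
theorem gauss_identity {lam : ℝ} (hL : laguerreTensor x ξ u = lam • metric x ξ u)
    {Q : Matrix (Fin n) (Fin n) ℝ} (hQ : Qᵀ * metric x ξ u * Q = 1)
    {X : Fin n → LSpace n} (hX : ∀ j, X j = ∑ a, Q a j • pd a (position x ξ) u)
    (v w z v' w' z' : Euc n) :
    form (fderiv ℝ (fderiv ℝ (position x ξ)) u v w + fderiv ℝ (position x ξ) u z)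
        (fderiv ℝ (fderiv ℝ (position x ξ)) u v' w' + fderiv ℝ (position x ξ) u z') =
      ∑ j, form (fderiv ℝ (fderiv ℝ (position x ξ)) u v w + fderiv ℝ (position x ξ) u z) (X j) *
        form (fderiv ℝ (fderiv ℝ (position x ξ)) u v' w' + fderiv ℝ (position x ξ) u z') (X j) -
      2 * lam * form (fderiv ℝ (position x ξ) u v) (fderiv ℝ (position x ξ) u w) *
        form (fderiv ℝ (position x ξ) u v') (fderiv ℝ (position x ξ) u w') := by
  have hsum : ∀ v w, fderiv ℝ (fderiv ℝ (position x ξ)) u v w =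
      ∑ a, ∑ b, (v a * w b) • pd a (pd b (position x ξ)) u := by
    intro v w
    conv_lhs => rw [← (EuclideanSpace.basisFun (Fin n) ℝ).sum_repr v,
      ← (EuclideanSpace.basisFun (Fin n) ℝ).sum_repr w]
    simp only [map_sum, map_smul, _root_.sum_apply, _root_.smul_apply, Finset.smul_sum, smul_smul,
      pd_pd H.isOpen H.contDiffOn_position hu]
    simp
    rw [Finset.sum_comm]
    simp only [mul_comm]
  have hG : ∀ v w, form (fderiv ℝ (position x ξ) u v) (fderiv ℝ (position x ξ) u w) =
      ∑ a, ∑ b, v a * w b * metric x ξ u a b := by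
    intro v w
    rw [fderiv_eq_sum_pd, fderiv_eq_sum_pd _ _ w, form_sum_left]
    simp only [form_sum_right, form_smul_left, form_smul_right, H.form_pd_position_pd_position hu]
    exact Finset.sum_congr rfl fun a _ => Finset.sum_congr rfl fun b _ => by ring
  -- For `W` normal to $dY$, the product with a second derivative is tensorial: the added tangent
  -- vector $dY(z)$ does not matter. Below, `W` is $Y$, $P$ and $N$, with factors $-1$, $0$ and
  -- $-\lambda$.
  have hT : ∀ W, (∀ a, form (pd a (position x ξ) u) W = 0) → ∀ c : ℝ,
      (∀ a b, form (pd a (pd b (position x ξ)) u) W = c * metric x ξ u a b) → ∀ v w z,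
      form (fderiv ℝ (fderiv ℝ (position x ξ)) u v w + fderiv ℝ (position x ξ) u z) W =
        c * form (fderiv ℝ (position x ξ) u v) (fderiv ℝ (position x ξ) u w) := by
    intro W hW c hc v w z
    rw [hG, hsum, fderiv_eq_sum_pd _ _ z, form_add_left, form_sum_left, form_sum_left]
    simp only [form_sum_left, form_smul_left, hW, hc, mul_zero, Finset.sum_const_zero, add_zero,
      Finset.mul_sum]
    exact Finset.sum_congr rfl fun a _ => Finset.sum_congr rfl fun b _ => by ring
  have hY := hT _ (H.form_pd_position_position hu) (-1) fun a b => by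
    rw [H.form_pd_pd_position_position hu, neg_one_mul]
  have hP := hT _ (H.form_pd_position_isotropicVector hu) 0 fun a b => by
    rw [H.form_pd_pd_position_isotropicVector hu, zero_mul]
  have hN := hT _ (H.form_pd_position_nVector hu) (-lam) fun a b => by
    have h := congrFun (congrFun hL a) b
    rw [laguerreTensor, of_apply, form_hess_of_orthogonal (H.form_pd_position_nVector hu),
      Matrix.smul_apply, smul_eq_mul] at h
    linarith
  have hexp := H.expansion hu hQ hX
    (fderiv ℝ (fderiv ℝ (position x ξ)) u v w + fderiv ℝ (position x ξ) u z)
  rw [hY, hP, hN] at hexp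
  set Z := fderiv ℝ (fderiv ℝ (position x ξ)) u v w + fderiv ℝ (position x ξ) u z with hZ
  set Z' := fderiv ℝ (fderiv ℝ (position x ξ)) u v' w' + fderiv ℝ (position x ξ) u z' with hZ'
  -- Only the first factor is expanded. Its $\eta$-coefficient is zero, its $P$-part is orthogonal
  -- to `Z'`, and the $Y$- and $N$-parts each contribute one $-\lambda$ term.
  have h1 : form Z Z' = form (∑ j, form Z (X j) • X j -
      (-lam * form (fderiv ℝ (position x ξ) u v) (fderiv ℝ (position x ξ) u w)) • position x ξ u -
      (-1 * form (fderiv ℝ (position x ξ) u v) (fderiv ℝ (position x ξ) u w)) • nVector x ξ u -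
      (0 * form (fderiv ℝ (position x ξ) u v) (fderiv ℝ (position x ξ) u w)) • eta x ξ u -
      form Z (eta x ξ u) • isotropicVector n) Z' := congrArg (form · Z') hexp
  rw [h1]
  simp only [form_sub_left, form_smul_left, form_sum_left]
  rw [form_comm _ Z', form_comm _ Z', form_comm _ Z', hY, hN]
  rw [form_comm (isotropicVector n), hP]
  simp only [form_comm (X _) Z']
  ring

end IsLocalHypersurface

/-! ### Smooth eigenvector fields and the vanishing of $\lambda$ -/

namespace IsLocalHypersurface

open Matrix Polynomial

variable {n : ℕ} {x ξ : Euc n → Euc (n + 1)} {O : Set (Euc n)} (H : IsLocalHypersurface x ξ O)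
  {u : Euc n}
include H

theorem smoothEntries_laguerreSecondForm : SmoothEntries (laguerreSecondForm x ξ) O :=
  fun a b => (contDiffOn_form (contDiffOn_pd H.isOpen H.contDiffOn_position b)
    (contDiffOn_pd H.isOpen H.contDiffOn_eta a)).congr fun _ hw => H.laguerreSecondForm_apply hw a b

theorem form_fderiv_position (hu : u ∈ O) (v w : Euc n) :
    form (fderiv ℝ (position x ξ) u v) (fderiv ℝ (position x ξ) u w) =
      ∑ a, v a * (metric x ξ u *ᵥ w.ofLp) a := by
  rw [fderiv_eq_sum_pd, fderiv_eq_sum_pd _ _ w, form_sum_left]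
  simp only [form_sum_right, form_smul_left, form_smul_right, H.form_pd_position_pd_position hu,
    mulVec, dotProduct]
  refine Finset.sum_congr rfl fun a _ => ?_
  rw [Finset.mul_sum]
  exact Finset.sum_congr rfl fun b _ => by ring

theorem form_fderiv_eta_fderiv_position (hu : u ∈ O) (v w : Euc n) :
    form (fderiv ℝ (eta x ξ) u v) (fderiv ℝ (position x ξ) u w) =
      ∑ a, v a * (laguerreSecondForm x ξ u *ᵥ w.ofLp) a := by
  rw [fderiv_eq_sum_pd, fderiv_eq_sum_pd _ _ w, form_sum_left]
  simp only [form_sum_right, form_smul_left, form_smul_right, mulVec, dotProduct]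
  refine Finset.sum_congr rfl fun a _ => ?_
  rw [Finset.mul_sum]
  refine Finset.sum_congr rfl fun b _ => ?_
  rw [H.laguerreSecondForm_apply hu, form_comm]
  ring

theorem fderiv_eta_of_eigenvector (hu : u ∈ O) (hC : ∀ a, laguerreForm x ξ u a = 0)
    {v : Euc n} {μ : ℝ}
    (hv : ((metric x ξ u)⁻¹ * laguerreSecondForm x ξ u) *ᵥ v.ofLp = μ • v.ofLp) :
    fderiv ℝ (eta x ξ) u v = μ • fderiv ℝ (position x ξ) u v := by
  rw [fderiv_eq_sum_pd, fderiv_eq_sum_pd (position x ξ)]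
  simp only [H.pd_eta_eq hu hC, Finset.smul_sum, smul_smul]
  rw [Finset.sum_comm]
  refine Finset.sum_congr rfl fun c _ => ?_
  rw [← Finset.sum_smul]
  congr 1
  have := congrFun hv c
  rw [Pi.smul_apply, smul_eq_mul] at this
  rw [← this, mulVec, dotProduct]
  exact Finset.sum_congr rfl fun a _ => mul_comm _ _

/-- An `L`-isotropic hypersurface with constant Laguerre principal curvatures has vanishing
Laguerre tensor. -/
theorem isotropic_constant_eq_zero {u₀ : Euc n} (hu₀ : u₀ ∈ O)
    (hC : ∀ w ∈ O, ∀ a, laguerreForm x ξ w a = 0) {lam : ℝ}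
    (hL : laguerreTensor x ξ u₀ = lam • metric x ξ u₀) {β : Multiset ℝ}
    (hβ : ∀ w ∈ O, laguerrePrincipalCurvatures x ξ w = β) : lam = 0 := by
  obtain ⟨Q, d, hQ, hd, -, hne⟩ := H.exists_laguerre_frame hu₀
  set A : Euc n → Matrix (Fin n) (Fin n) ℝ :=
    fun w => (metric x ξ w)⁻¹ * laguerreSecondForm x ξ w with hA
  have hAs : SmoothEntries A O := H.smoothEntries_metric_inv.mul H.smoothEntries_laguerreSecondForm
  choose q hq1 hq0 using fun j => exists_eval_eq_one_zero β.toFinset (d j)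
  -- Each eigenvector at `u₀` is frozen and projected to the eigenspace of $A(w)$ for the same
  -- eigenvalue. This is smooth because the spectrum is constant, so one polynomial `q j` serves for
  -- all `w`; orthonormality is kept only at `u₀`.
  set V : Fin n → Euc n → Euc n :=
    fun j w => WithLp.toLp 2 (aeval (A w) (q j) *ᵥ Q.col j) with hV
  have hAV : ∀ w ∈ O, ∀ j, A w *ᵥ (V j w).ofLp = d j • (V j w).ofLp := by
    intro w hw j
    obtain ⟨Q', d', hQ', hd', -⟩ := H.exists_laguerre_frame hw
    have h0 : aeval (A w) (q j * (X - C (d j))) = 0 :=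
      aeval_eq_zero_of_eigenvalues hQ' hd' _ fun ν hν => hq0 j ν (by
        have := hβ w hw
        rw [laguerrePrincipalCurvatures] at this
        rw [this] at hν
        exact Multiset.mem_toFinset.2 hν)
    rw [mul_comm, map_mul, map_sub, aeval_X, aeval_C] at h0
    have h1 := congrArg (· *ᵥ Q.col j) h0
    simp only [zero_mulVec] at h1
    rw [← mulVec_mulVec, sub_mulVec, Algebra.algebraMap_eq_smul_one, smul_mulVec, one_mulVec,
      sub_eq_zero] at h1
    exact h1
  have hVs : ∀ j, ContDiffOn ℝ ∞ (V j) O := by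
    intro j
    rw [contDiffOn_euclidean]
    intro a
    have : ContDiffOn ℝ ∞ (fun w => ∑ b, aeval (A w) (q j) a b * Q b j) O :=
      ContDiffOn.sum fun b _ => (hAs.aeval (q j) a b).mul contDiffOn_const
    exact this
  have hV₀ : ∀ j, (V j u₀).ofLp = Q.col j := by
    intro j
    have h1 : A u₀ *ᵥ Q.col j = d j • Q.col j := by
      ext b
      have := congrFun (congrFun (inv_mul_mul_eq hQ hd) b) j
      rw [mul_diagonal] at this
      rw [Pi.smul_apply, smul_eq_mul, mul_comm]
      exact this
    change aeval (A u₀) (q j) *ᵥ Q.col j = Q.col j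
    rw [aeval_mulVec_of_eigenvector h1, hq1, one_smul]
  have hX : ∀ j, dirDeriv (V j) (position x ξ) u₀ = ∑ a, Q a j • pd a (position x ξ) u₀ := by
    intro j
    rw [dirDeriv, fderiv_eq_sum_pd, hV₀]
    rfl
  refine eq_zero_of_cartan_identity hne fun i k hik => ?_
  refine cartan_identity H.isOpen hu₀ H.contDiffOn_position H.contDiffOn_eta hVs
    (fun w hw j => H.fderiv_eta_of_eigenvector hw (hC w hw) (hAV w hw j)) ?_ ?_ ?_
    (H.gauss_identity hu₀ hL hQ hX) hik
  · intro w hw v k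
    rw [dirDeriv, H.form_fderiv_eta_fderiv_position hw, H.form_fderiv_position hw, Finset.mul_sum]
    have h1 : laguerreSecondForm x ξ w *ᵥ (V k w).ofLp = d k • (metric x ξ w *ᵥ (V k w).ofLp) := by
      have h2 : metric x ξ w * A w = laguerreSecondForm x ξ w := by
        rw [hA, ← Matrix.mul_assoc,
          mul_nonsing_inv _ (isUnit_iff_ne_zero.2 (H.metric_det_ne_zero hw)), Matrix.one_mul]
      rw [← mulVec_smul, ← hAV w hw k, mulVec_mulVec _ _ (A w), h2]
    refine Finset.sum_congr rfl fun a _ => ?_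
    rw [h1, Pi.smul_apply, smul_eq_mul]
    ring
  · intro i j
    rw [dirDeriv, dirDeriv, H.form_fderiv_position hu₀, hV₀, hV₀]
    have := congrFun (congrFun hQ i) j
    rw [Matrix.one_apply, Matrix.mul_assoc, Matrix.mul_apply] at this
    exact this
  · intro v
    have h1 : v.ofLp = Q *ᵥ ((Qᵀ * metric x ξ u₀) *ᵥ v.ofLp) := by
      rw [mulVec_mulVec, mul_transpose_mul_eq_one hQ, one_mulVec]
    ext a
    conv_lhs => rw [h1]
    rw [WithLp.ofLp_sum, Finset.sum_apply, mulVec, dotProduct]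
    refine Finset.sum_congr rfl fun j _ => ?_
    rw [dirDeriv, form_comm, H.form_fderiv_position hu₀, WithLp.ofLp_smul, Pi.smul_apply, hV₀,
      smul_eq_mul, mul_comm, ← mulVec_mulVec]
    rfl

end IsLocalHypersurface

/-! ### Passage to charts -/

section Global

variable {n : ℕ} {M : Type*} [TopologicalSpace M] [ChartedSpace (Euc n) M] [IsManifold (𝓡 n) ∞ M]
  {x ξ : M → Euc (n + 1)}

/-- An oriented hypersurface in a chart. -/
theorem IsOrientedHypersurface.isLocalHypersurface (hx : IsOrientedHypersurface x ξ)
    (hk : NonvanishingCurvatures x ξ) (hu : UmbilicFree x ξ) {e : OpenPartialHomeomorph M (Euc n)}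
    (he : e ∈ atlas (Euc n) M) :
    IsLocalHypersurface (x ∘ e.symm) (ξ ∘ e.symm) e.target := by
  have he' : e ∈ IsManifold.maximalAtlas (𝓡 n) ∞ M := IsManifold.subset_maximalAtlas he
  have : IsManifold (𝓡 n) 1 M := IsManifold.of_le (n := ∞) (by simp)
  have hsymm := contMDiffOn_symm_of_mem_maximalAtlas he'
  have hmd := mdifferentiable_of_mem_atlas (I := 𝓡 n) he
  -- The chain rule transfers normality and injectivity of the differential from $M$ to the chart.
  have hpd : ∀ u ∈ e.target, ∀ v : Euc n, fderiv ℝ (x ∘ e.symm) u v =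
      mfderiv (𝓡 n) 𝓘(ℝ, Euc (n + 1)) x (e.symm u) (mfderiv (𝓡 n) (𝓡 n) e.symm u v) := by
    intro u hu' v
    rw [← mfderiv_eq_fderiv, mfderiv_comp u
      (hx.smooth.mdifferentiableAt (by simp)) (hmd.mdifferentiableAt_symm hu')]
    rfl
  refine ⟨e.open_target, ?_, ?_, fun u _ => ?_, fun u hu' a => ?_, fun u hu' => ?_, hk e he,
    hu e he⟩
  · exact contMDiffOn_iff_contDiffOn.1 (hx.smooth.comp_contMDiffOn hsymm)
  · exact contMDiffOn_iff_contDiffOn.1 (hx.smooth_normal.comp_contMDiffOn hsymm)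
  · rw [real_inner_self_eq_norm_sq, Function.comp_apply, hx.unit, one_pow]
  · rw [pd, hpd u hu']
    exact hx.normal (e.symm u) _
  · have h1 : LinearIndependent ℝ fun a : Fin n => EuclideanSpace.single a (1 : ℝ) := by
      have h2 := (EuclideanSpace.basisFun (Fin n) ℝ).toBasis.linearIndependent
      rw [OrthonormalBasis.coe_toBasis] at h2
      have h3 : ⇑(EuclideanSpace.basisFun (Fin n) ℝ) = fun a => EuclideanSpace.single a 1 :=
        funext fun a => EuclideanSpace.basisFun_apply _ _ a
      rwa [h3] at h2
    refine h1.map_injOn (fderiv ℝ (x ∘ e.symm) u).toLinearMap (Function.Injective.injOn ?_)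
    intro v w hvw
    change fderiv ℝ (x ∘ e.symm) u v = fderiv ℝ (x ∘ e.symm) u w at hvw
    rw [hpd u hu', hpd u hu'] at hvw
    exact hmd.symm.mfderiv_injective hu' (hx.immersion _ hvw)

end Global

end Laguerre

end

theorem mainTheorem2 {n : ℕ} (hn : 3 ≤ n) {M : Type*} [TopologicalSpace M]
    [ChartedSpace (Laguerre.Euc n) M] [IsManifold (𝓡 n) ∞ M] [Nonempty M]
    (x ξ : M → Laguerre.Euc (n + 1)) (hx : Laguerre.IsOrientedHypersurface x ξ)
    (hk : Laguerre.NonvanishingCurvatures x ξ) (hu : Laguerre.UmbilicFree x ξ)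
    (lam : ℝ) (hiso : Laguerre.IsLIsotropic x ξ lam) (hpar : Laguerre.IsLIsoparametric x ξ) :
    lam = 0 ∧
      ∀ e ∈ atlas (Laguerre.Euc n) M, ∀ u ∈ e.target,
        Laguerre.tensorEigenvalues (x ∘ e.symm) (ξ ∘ e.symm) u = Multiset.replicate n 0 := by
  have hlam : lam = 0 := by
    obtain ⟨p⟩ := ‹Nonempty M›
    obtain ⟨hC, β, hβ⟩ := hpar
    have he := chart_mem_atlas (Laguerre.Euc n) p
    have hp := mem_chart_target (Laguerre.Euc n) p
    exact (hx.isLocalHypersurface hk hu he).isotropic_constant_eq_zero hp (hC _ he)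
      (hiso.2 _ he _ hp) (hβ _ he)
  refine ⟨hlam, fun e he u hu' => ?_⟩
  rw [Laguerre.tensorEigenvalues, hiso.2 e he u hu', hlam, zero_smul, Laguerre.eigenvaluesRel,
    Matrix.mul_zero, Matrix.charpoly_zero, Polynomial.roots_pow, Polynomial.roots_X,
    Fintype.card_fin, Multiset.nsmul_singleton]
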